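/- Let $q$ be a complex polynomial with $q(z)=z^2+az^3+O(z^4)$ as $z\to0$, let $f(z)=z+q(z)$, and for $\delta\in\mathbb C$, $0<|\delta|<1$, let $$F(z,x)=F^\delta(z,x)=\bigl(z+q(z+\delta x),\ \delta x-q(z+\delta x)\bigr),\qquad (z,x)\in\mathbb C^2 .$$ Let $\mathcal B_f\subset\mathbb C$ and $\mathcal B_F\subset\mathbb C^2$ be the parabolic basins of the fixed points at the origin, i.e. the open sets of points having a neighbourhood on which the iterates converge uniformly to the origin. Let $\pi_z(z,x)=z$, and for $b\in\mathbb C$ let $$\omega_b^{\iota}(z)=-\tfrac1z-b\log\bigl(-\tfrac1z\bigr),\qquad \omega_b^{o}(z)=-\tfrac1z-b\log\bigl(\tfrac1z\bigr)$$ with the principal logarithm, where $(\omega_b^{o})^{-1}$ denotes the inverse of the restriction of $\omega_b^o$ to $\{\operatorname{Re}(1/z)>|b|+1\}$, on which $\omega_b^o$ is injective. With $b=1-a$ for $f$ and $b_\delta=1-a+\frac{2\delta}{1-\delta}$ for $F^\delta$, the attracting and repelling Fatou coordinates are $$\phi_f(z)=\lim_{n\to\infty}\bigl(\omega_b^\iota(f^n(z))-n\bigr)\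 (z\in\mathcal B_f),\qquad \psi_f(Z)=\lim_{n\to\infty}f^n\bigl((\omega_b^o)^{-1}(Z-n)\bigr)\ (Z\in\mathbb C),$$ $$\Phi_F(p)=\lim_{n\to\infty}\bigl(\omega_{b_\delta}^\iota(\pi_z F^n(p))-n\bigr)\ (p\in\mathcal B_F),\qquad \Psi_F(Z)=\lim_{n\to\infty}F^n\bigl((\omega_{b_\delta}^o)^{-1}(Z-n),0\bigr)\ (Z\in\mathbb C),$$ and the (phase $0$) Lavaurs maps are $\mathcal L_f=\psi_f\circ\phi_f:\mathcal B_f\to\mathbb C$ and $\mathcal L_F=\Psi_F\circ\Phi_F:\mathcal B_F\to\mathbb C^2$. A fixed point of one of these maps is called attracting if all eigenvalues of the derivative of the map there have modulus less than $1$. Suppose that $\mathcal L_f$ has an attracting fixed point in $\mathcal B_f$. Then there is $\delta_0>0$ such that for every $\delta\in\mathbb C$ with $0<|\delta|<\delta_0$ the Lavaurs map $\mathcal L_F$ of $F=F^\delta$ has an attracting fixed point $(\hat z,\hat x)\in\mathcal B_F$. (In particular, the limits defining $\Phi_F$ exist at all points near $(\hat z,\hat x)$, and those defining $\Psi_F$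 exist at all points near $\Phi_F(\hat z,\hat x)$.) -/

import Mathlib

open Filter Topology Polynomial

noncomputable section

/-- The polynomial map `f(z) = z + q(z)` of `ℂ`. -/
def oneDimMap (q : ℂ[X]) (z : ℂ) : ℂ :=
  z + q.eval z

/-- The map `F(z, x) = (z + q(z + δ x), δ x - q(z + δ x))` of `ℂ²`. -/
def twoDimMap (q : ℂ[X]) (δ : ℂ) (p : ℂ × ℂ) : ℂ × ℂ :=
  (p.1 + q.eval (p.1 + δ * p.2), δ * p.2 - q.eval (p.1 + δ * p.2))

/-- The parabolic basin of the fixed point `0` of `T`: the open set of points that have a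
neighbourhood on which the iterates of `T` converge uniformly to `0`. (A point whose orbit
lands on `0`, or a point of the strong stable manifold of a semi-parabolic fixed point,
is not in it.) -/
def parabolicBasin {E : Type*} [NormedAddCommGroup E] (T : E → E) : Set E :=
  {p | ∃ U ∈ 𝓝 p, TendstoUniformlyOn (fun n : ℕ => T^[n]) (fun _ => 0) atTop U}

/-- The incoming coordinate `-1/z - b log(-1/z)`, used for `-1/z` near `+∞`. -/
def omegaIn (b z : ℂ) : ℂ :=
  -1 / z - b * Complex.log (-1 / z)

/-- The outgoing coordinate `-1/z - b log(1/z)`, used for `-1/z` near `-∞`. -/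
def omegaOut (b z : ℂ) : ℂ :=
  -1 / z - b * Complex.log (1 / z)

/-- The inverse of the outgoing coordinate on the disc `Re (1/z) > |b| + 1`, on which that
coordinate is injective. For every `Z`, the point `Z - n` is in the range for large `n`. -/
def omegaOutInv (b Z : ℂ) : ℂ :=
  Function.invFunOn (omegaOut b) {z : ℂ | ‖b‖ + 1 < (1 / z).re} Z

/-- `b = 1 - a` for `f(z) = z + z² + a z³ + O(z⁴)`. -/
def oneDimB (q : ℂ[X]) : ℂ :=
  1 - q.coeff 3

/-- `b = 1 - a₃` for the two-dimensional map, where `a₃ = a - 2δ/(1 - δ)` is the coefficient of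
`z³` in the first component of the map, once the coordinates are such that this component is
`z + z² + a₃ z³ + O(z⁴)` with `a₃` not depending on `x`. Equivalently it is the coefficient of
`z³` in the first component along the invariant formal curve `x = -z²/(1 - δ) + O(z³)`. -/
def twoDimB (q : ℂ[X]) (δ : ℂ) : ℂ :=
  1 - (q.coeff 3 - 2 * δ / (1 - δ))

/-- The approximants `ω(fⁿ(z)) - n` of the attracting Fatou coordinate of `f`. -/
def attractingSeq₁ (q : ℂ[X]) (z : ℂ) (n : ℕ) : ℂ :=
  omegaIn (oneDimB q) ((oneDimMap q)^[n] z) - n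

/-- The approximants `fⁿ(ω⁻¹(Z - n))` of the repelling Fatou coordinate of `f`. -/
def repellingSeq₁ (q : ℂ[X]) (Z : ℂ) (n : ℕ) : ℂ :=
  (oneDimMap q)^[n] (omegaOutInv (oneDimB q) (Z - n))

/-- The attracting Fatou coordinate of `f`, on the parabolic basin. -/
def attractingFatou₁ (q : ℂ[X]) (z : ℂ) : ℂ :=
  limUnder atTop (attractingSeq₁ q z)

/-- The repelling Fatou coordinate `ℂ → ℂ` of `f`. -/
def repellingFatou₁ (q : ℂ[X]) (Z : ℂ) : ℂ :=
  limUnder atTop (repellingSeq₁ q Z)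

/-- The (phase `0`) Lavaurs map of `f`, on the parabolic basin. -/
def lavaurs₁ (q : ℂ[X]) (z : ℂ) : ℂ :=
  repellingFatou₁ q (attractingFatou₁ q z)

/-- The approximants `ω(π_z(Fⁿ(z, x))) - n` of the attracting Fatou coordinate of `F`. On the
parabolic basin the orbit satisfies `x = O(z²)`, so that a local change of coordinates
`(z, x) ↦ (z + O(x², z x), x)` before `ω` does not change the limit. -/
def attractingSeq₂ (q : ℂ[X]) (δ : ℂ) (p : ℂ × ℂ) (n : ℕ) : ℂ :=
  omegaIn (twoDimB q δ) ((twoDimMap q δ)^[n] p).1 - n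

/-- The approximants `Fⁿ(ω⁻¹(Z - n), 0)` of the repelling Fatou coordinate of `F`. The points
`(z, 0)` are fixed by every change of coordinates `(z, x) ↦ (z + O(x², z x), x)`. -/
def repellingSeq₂ (q : ℂ[X]) (δ Z : ℂ) (n : ℕ) : ℂ × ℂ :=
  (twoDimMap q δ)^[n] (omegaOutInv (twoDimB q δ) (Z - n), 0)

/-- The attracting Fatou coordinate of `F`, on the parabolic basin. -/
def attractingFatou₂ (q : ℂ[X]) (δ : ℂ) (p : ℂ × ℂ) : ℂ :=
  limUnder atTop (attractingSeq₂ q δ p)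

/-- The repelling Fatou coordinate `ℂ → ℂ²` of `F`. -/
def repellingFatou₂ (q : ℂ[X]) (δ Z : ℂ) : ℂ × ℂ :=
  limUnder atTop (repellingSeq₂ q δ Z)

/-- The (phase `0`) Lavaurs map of `F`, on the parabolic basin. -/
def lavaurs₂ (q : ℂ[X]) (δ : ℂ) (p : ℂ × ℂ) : ℂ × ℂ :=
  repellingFatou₂ q δ (attractingFatou₂ q δ p)

/-- `p` is an attracting fixed point of `L`: `L` fixes `p`, is complex differentiable at `p`,
and all eigenvalues of its derivative there have modulus less than `1`. (On `E = ℂ` this says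
that the multiplier has modulus less than `1`.) -/
def IsAttractingFixedPoint {E : Type*} [NormedAddCommGroup E] [NormedSpace ℂ E]
    (L : E → E) (p : E) : Prop :=
  L p = p ∧ ∃ A : E →L[ℂ] E, HasFDerivAt L A p ∧
    ∀ μ : ℂ, Module.End.HasEigenvalue (A : E →ₗ[ℂ] E) μ → ‖μ‖ < 1

end

/-! A fixed point `Z` of the one-variable map `G_δ = Φ_F ∘ Ψ_F` gives a fixed point `Ψ_F(Z)` of the
Lavaurs map `Ψ_F ∘ Φ_F`. The derivative there factors through `ℂ`, so its only possible nonzero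
eigenvalue is `G_δ'(Z)`. At `δ = 0` the first coordinate is iterated by `f` alone, hence `Φ_F = φ_f
∘ π_z` and `π_z ∘ Ψ_F = ψ_f`. Thus `G_0 = φ_f ∘ ψ_f` fixes `φ_f(z)`, with the multiplier of the
Lavaurs map of `f` at its fixed point `z`. As this multiplier is not `1`, the implicit function
theorem continues the fixed point to small `δ`, and continuity keeps the multiplier below `1` in
modulus (`eventually_exists_fixedPoint`).

What remains is that `Φ_F` and `Ψ_F` are holomorphic jointly in the parameter and the point, near `δ
= 0` inclusive, where `F` is not invertible. Both are obtained as uniform limits. In the coordinates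
`u = -1/z`, `ζ = -x/z` the map is `u ↦ u + 1 - 2δζ + (a-1)z`, `ζ ↦ δζ + z`, up to second order, and
`u - b_δ log(±u) - 2δ/(1-δ) ζ` is translated by `1` up to `O((|z|+|ζ|)²)`
(`exists_approxFatou_bound`). The cone `|ζ| ≤ 4|z|` is invariant.

On the attracting side `Re u` grows linearly, so the errors are summable
(`tendstoUniformlyOn_attractingPetal`), and orbits over the basin of `f` enter the petal
(`exists_iterate_attractingPetal_mem_nhds`). On the repelling side no inverse branch is used:
forward orbits started at levels `n > m` are compared when both are at level `m`, where they are
`O(1/m)` apart, and a weighted distance grows only by a bounded factor from there to a fixed level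
`N` (`weightedDist_le`, `weightedDist_iterate`). -/

section HolomorphicLimits

/-! ### Cauchy estimates and holomorphic limits -/

open Metric

variable {E F : Type*} [NormedAddCommGroup E] [NormedSpace ℂ E] [NormedAddCommGroup F]
  [NormedSpace ℂ F]

/-- Cauchy estimate for the Fréchet derivative. -/
theorem norm_fderiv_le_of_norm_le_ball {f : E → F} {c : E} {R C : ℝ} (hR : 0 < R)
    (hd : DifferentiableOn ℂ f (ball c R)) (hC : ∀ x ∈ ball c R, ‖f x‖ ≤ C) :
    ‖fderiv ℂ f c‖ ≤ 2 * C / R := by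
  refine Complex.norm_fderiv_le_div_of_mapsTo_ball hd (fun x hx => ?_) hR
  rw [mem_closedBall, dist_eq_norm]
  linarith [norm_sub_le (f x) (f c), hC x hx, hC c (mem_ball_self hR)]

/-- A uniform limit of holomorphic functions on a ball is holomorphic on the concentric ball of
half the radius. -/
theorem differentiableOn_half_ball_of_tendstoUniformlyOn [CompleteSpace F] {f : ℕ → E → F} {g : E → F}
    {c : E} {R : ℝ} (hR : 0 < R) (hf : ∀ᶠ n in atTop, DifferentiableOn ℂ (f n) (ball c R))
    (hfg : TendstoUniformlyOn f g atTop (ball c R)) :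
    DifferentiableOn ℂ g (ball c (R / 2)) := by
  have hsub : ∀ x ∈ ball c (R / 2), ball x (R / 2) ⊆ ball c R := fun x hx =>
    ball_subset_ball' (by rw [mem_ball] at hx; linarith)
  -- Around each point of the half ball there is a ball of radius `R / 2` in the domain, so the
  -- Cauchy estimate for `f m - f n` is uniform.
  have hcau : UniformCauchySeqOn (fun n => fderiv ℂ (f n)) atTop (ball c (R / 2)) := by
    rw [Metric.uniformCauchySeqOn_iff]
    intro ε hε
    obtain ⟨N₁, hN₁⟩ := Metric.uniformCauchySeqOn_iff.1 hfg.uniformCauchySeqOn (ε * R / 8)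
      (by positivity)
    obtain ⟨N₂, hN₂⟩ := eventually_atTop.1 hf
    refine ⟨max N₁ N₂, fun m hm n hn x hx => ?_⟩
    have hdm := (hN₂ m (le_of_max_le_right hm)).mono (hsub x hx)
    have hdn := (hN₂ n (le_of_max_le_right hn)).mono (hsub x hx)
    have hxm : x ∈ ball x (R / 2) := mem_ball_self (by linarith)
    have h1 : fderiv ℂ (fun y => f m y - f n y) x = fderiv ℂ (f m) x - fderiv ℂ (f n) x :=
      fderiv_fun_sub (hdm.differentiableAt (isOpen_ball.mem_nhds hxm))
        (hdn.differentiableAt (isOpen_ball.mem_nhds hxm))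
    have h2 := norm_fderiv_le_of_norm_le_ball (C := ε * R / 8) (half_pos hR) (hdm.fun_sub hdn)
      (fun y hy => by
        have := hN₁ m (le_of_max_le_left hm) n (le_of_max_le_left hn) y (hsub x hx hy)
        rw [dist_eq_norm] at this
        exact this.le)
    rw [h1] at h2
    rw [dist_eq_norm]
    have : 2 * (ε * R / 8) / (R / 2) = ε / 2 := by field_simp; norm_num
    linarith
  obtain ⟨N, hN⟩ := eventually_atTop.1 hf
  have hlim : ∀ x ∈ ball c (R / 2), ∃ A, Tendsto (fun n => fderiv ℂ (f n) x) atTop (𝓝 A) :=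
    fun x hx => cauchySeq_tendsto_of_complete (hcau.cauchySeq hx)
  choose! g' hg' using hlim
  have hu := hcau.tendstoUniformlyOn_of_tendsto hg'
  have hshift : Tendsto (fun n => n + N) atTop atTop := tendsto_add_atTop_nat N
  intro x hx
  refine (hasFDerivAt_of_tendstoUniformlyOn (l := atTop) (f := fun n => f (n + N))
    (f' := fun n => fderiv ℂ (f (n + N))) (g' := g') isOpen_ball (s := ball c (R / 2))
    ?_ ?_ ?_ hx).differentiableAt.differentiableWithinAt
  · intro u hu'
    exact hshift.eventually (hu u hu')
  · intro n y hy
    exact (((hN (n + N) (Nat.le_add_left _ _)).mono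
      (ball_subset_ball (by linarith))).differentiableAt (isOpen_ball.mem_nhds hy)).hasFDerivAt
  · intro y hy
    exact (hfg.tendsto_at (ball_subset_ball (by linarith) hy)).comp hshift

/-- The derivative of a holomorphic function on an open set of a finite-dimensional space is
continuous. -/
theorem continuousAt_fderiv_of_differentiableOn [ProperSpace E] {f : E → F} {U : Set E}
    (hU : IsOpen U) (hf : DifferentiableOn ℂ f U) {c : E} (hc : c ∈ U) :
    ContinuousAt (fderiv ℂ f) c := by
  obtain ⟨R, hR, hRU⟩ := nhds_basis_closedBall.mem_iff.1 (hU.mem_nhds hc)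
  have huc := (isCompact_closedBall c R).uniformContinuousOn_of_continuous
    (hf.continuousOn.mono hRU)
  rw [Metric.uniformContinuousOn_iff] at huc
  rw [Metric.continuousAt_iff]
  intro ε hε
  obtain ⟨η, hη, h⟩ := huc (ε * R / 8) (by positivity)
  refine ⟨min η (R / 2), by positivity, fun {x} hx => ?_⟩
  have hx1 : dist x c < η := lt_of_lt_of_le hx (min_le_left _ _)
  have hx2 : dist x c < R / 2 := lt_of_lt_of_le hx (min_le_right _ _)
  have hball : ∀ y ∈ ball (0 : E) (R / 2), x + y ∈ closedBall c R ∧ c + y ∈ closedBall c R := by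
    intro y hy
    rw [mem_ball_zero_iff] at hy
    rw [dist_eq_norm] at hx2
    constructor
    · rw [mem_closedBall, dist_eq_norm, add_sub_right_comm]
      linarith [norm_add_le (x - c) y]
    · rw [mem_closedBall, dist_eq_norm, add_sub_cancel_left]
      linarith
  have hdx : ∀ y ∈ ball (0 : E) (R / 2), DifferentiableAt ℂ (fun y => f (x + y)) y := fun y hy =>
    (hf.differentiableAt (hU.mem_nhds (hRU (hball y hy).1))).comp y
      ((differentiableAt_const x).add differentiableAt_id)
  have hdc : ∀ y ∈ ball (0 : E) (R / 2), DifferentiableAt ℂ (fun y => f (c + y)) y := fun y hy =>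
    (hf.differentiableAt (hU.mem_nhds (hRU (hball y hy).2))).comp y
      ((differentiableAt_const c).add differentiableAt_id)
  have h0 : (0 : E) ∈ ball (0 : E) (R / 2) := mem_ball_self (by linarith)
  -- The difference of the derivatives at `x` and `c` is the derivative at `0` of a difference of
  -- translates, which uniform continuity makes small.
  have h2 := norm_fderiv_le_of_norm_le_ball (f := fun y => f (x + y) - f (c + y)) (c := 0)
    (C := ε * R / 8) (half_pos hR)
    (fun y hy => ((hdx y hy).sub (hdc y hy)).differentiableWithinAt) (fun y hy => by
      have := h (x + y) (hball y hy).1 (c + y) (hball y hy).2 (by simpa using hx1)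
      rw [dist_eq_norm] at this
      exact this.le)
  rw [fderiv_fun_sub (hdx 0 h0) (hdc 0 h0), fderiv_comp_add_left, fderiv_comp_add_left, add_zero,
    add_zero] at h2
  rw [dist_eq_norm]
  have : 2 * (ε * R / 8) / (R / 2) = ε / 2 := by field_simp; norm_num
  linarith

/-- A holomorphic function on an open set of a finite-dimensional space is strictly
differentiable. -/
theorem hasStrictFDerivAt_of_differentiableOn [ProperSpace E] {f : E → F} {U : Set E}
    (hU : IsOpen U) (hf : DifferentiableOn ℂ f U) {c : E} (hc : c ∈ U) :
    HasStrictFDerivAt f (fderiv ℂ f c) c := by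
  refine hasStrictFDerivAt_of_hasFDerivAt_of_continuousAt (𝕜 := ℂ) (f' := fderiv ℂ f) ?_
    (continuousAt_fderiv_of_differentiableOn hU hf hc)
  filter_upwards [hU.mem_nhds hc] with x hx
  exact (hf.differentiableAt (hU.mem_nhds hx)).hasFDerivAt

end HolomorphicLimits

/-! ### One step of `F` in the coordinates `z` and `ζ = -x/z` -/

section LocalDynamics

/-- The polynomial `r` in `q(w) = w² (1 + a w + w² r(w))`. -/
noncomputable def tailPoly (q : ℂ[X]) : ℂ[X] :=
  q.divX.divX.divX.divX

theorem eval_eq_tailPoly {q : ℂ[X]} (h0 : q.coeff 0 = 0) (h1 : q.coeff 1 = 0)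
    (h2 : q.coeff 2 = 1) (w : ℂ) :
    q.eval w = w ^ 2 * (1 + q.coeff 3 * w + w ^ 2 * (tailPoly q).eval w) := by
  have e : ∀ p : ℂ[X], p.eval w = p.divX.eval w * w + p.coeff 0 := fun p => by
    conv_lhs => rw [← Polynomial.divX_mul_X_add p]
    simp
  have c1 : q.divX.coeff 0 = 0 := by simp [Polynomial.coeff_divX, h1]
  have c2 : q.divX.divX.coeff 0 = 1 := by simp [Polynomial.coeff_divX, h2]
  have c3 : q.divX.divX.divX.coeff 0 = q.coeff 3 := by simp [Polynomial.coeff_divX]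
  rw [e q, e q.divX, e q.divX.divX, e q.divX.divX.divX, h0, c1, c2, c3, tailPoly]
  ring

/-- The factor `s` in `q(z + δ x) = z² s`, where `x = -ζ z`. -/
noncomputable def stepFactor (q : ℂ[X]) (δ z ζ : ℂ) : ℂ :=
  (1 - δ * ζ) ^ 2 * (1 + q.coeff 3 * (z * (1 - δ * ζ)) +
    (z * (1 - δ * ζ)) ^ 2 * (tailPoly q).eval (z * (1 - δ * ζ)))

/-- The increment of `-1/z` under the map `F`, in the coordinates `z` and `ζ = -x/z`. -/
noncomputable def stepIncr (q : ℂ[X]) (δ z ζ : ℂ) : ℂ :=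
  stepFactor q δ z ζ / (1 + z * stepFactor q δ z ζ)

/-- The new value of `ζ = -x/z` under the map `F`, in the coordinates `z` and `ζ`. -/
noncomputable def stepFiber (q : ℂ[X]) (δ z ζ : ℂ) : ℂ :=
  (δ * ζ + z * stepFactor q δ z ζ) / (1 + z * stepFactor q δ z ζ)

theorem eval_add_mul_eq_stepFactor {q : ℂ[X]} (h0 : q.coeff 0 = 0) (h1 : q.coeff 1 = 0)
    (h2 : q.coeff 2 = 1) (δ z ζ : ℂ) :
    q.eval (z + δ * (-(ζ * z))) = z ^ 2 * stepFactor q δ z ζ := by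
  rw [eval_eq_tailPoly h0 h1 h2, stepFactor]
  have : z + δ * (-(ζ * z)) = z * (1 - δ * ζ) := by ring
  rw [this]
  ring

theorem twoDimMap_eq_stepFactor {q : ℂ[X]} (h0 : q.coeff 0 = 0) (h1 : q.coeff 1 = 0)
    (h2 : q.coeff 2 = 1) (δ z ζ : ℂ) :
    twoDimMap q δ (z, -(ζ * z)) = (z * (1 + z * stepFactor q δ z ζ),
      -(z * (δ * ζ + z * stepFactor q δ z ζ))) := by
  simp only [twoDimMap, eval_add_mul_eq_stepFactor h0 h1 h2]
  ext <;> simp only <;> ring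

theorem norm_div_le_two_mul {a d : ℂ} (hd : 1 / 2 ≤ ‖d‖) : ‖a / d‖ ≤ 2 * ‖a‖ := by
  rw [norm_div, div_le_iff₀ (by linarith)]
  nlinarith [norm_nonneg a]

/-- The factor depends on `z` and `ζ` through `δζ` and a polynomial in `w = z(1 - δζ)`, and `|w| ≤
2` here. Bounds for polynomials on this compact disc give constants independent of `δ`, as
uniformity up to `δ = 0` requires. -/
theorem exists_stepFactor_bounds (q : ℂ[X]) :
    ∃ M : ℝ, 1 ≤ M ∧ ∀ δ : ℂ, ‖δ‖ ≤ 1 / 8 → ∀ z ζ : ℂ, ‖z‖ ≤ 1 → ‖ζ‖ ≤ 1 →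
      ‖stepFactor q δ z ζ - 1 - q.coeff 3 * z + 2 * δ * ζ‖ ≤ M * (‖z‖ + ‖ζ‖) ^ 2 ∧
      ∀ z' ζ' : ℂ, ‖z'‖ ≤ 1 → ‖ζ'‖ ≤ 1 →
        ‖stepFactor q δ z ζ - stepFactor q δ z' ζ'‖ ≤ M * (‖z - z'‖ + ‖ζ - ζ'‖) := by
  set a := q.coeff 3 with ha
  set r := tailPoly q with hr
  set p : ℂ[X] := 1 + C a * X + X ^ 2 * r with hp
  have hpe : ∀ w, p.eval w = 1 + a * w + w ^ 2 * r.eval w := fun w => by simp [hp]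
  have hs : ∀ δ z ζ, stepFactor q δ z ζ = (1 - δ * ζ) ^ 2 * p.eval (z * (1 - δ * ζ)) :=
    fun δ z ζ => by rw [hpe, stepFactor]
  have hbd : ∀ f : ℂ[X], ∃ K : ℝ, 0 ≤ K ∧ ∀ w : ℂ, ‖w‖ ≤ 2 → ‖f.eval w‖ ≤ K := fun f => by
    obtain ⟨K, hK⟩ := (isCompact_closedBall (0 : ℂ) 2).exists_bound_of_continuousOn
      f.continuous.continuousOn
    exact ⟨K, (norm_nonneg _).trans (hK 0 (by simp)), fun w hw => hK w (by simpa using hw)⟩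
  obtain ⟨R, hR0, hR⟩ := hbd r
  obtain ⟨P, hP0, hP⟩ := hbd p
  obtain ⟨L, hL0, hL⟩ := hbd (derivative p)
  have hLip : ∀ w w' : ℂ, ‖w‖ ≤ 2 → ‖w'‖ ≤ 2 → ‖p.eval w - p.eval w'‖ ≤ L * ‖w - w'‖ := by
    intro w w' hw hw'
    refine (convex_closedBall (0 : ℂ) 2).norm_image_sub_le_of_norm_deriv_le (𝕜 := ℂ)
      (f := fun w => p.eval w) (fun x _ => p.differentiableAt) (fun x hx => ?_)
      (by simpa using hw') (by simpa using hw)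
    rw [Polynomial.deriv]
    exact hL x (by simpa using hx)
  -- The first three summands bound the three terms of the second-order remainder, the last two the
  -- Lipschitz constant.
  refine ⟨1 + 7 * ‖a‖ + 16 * R + 4 * P + 8 * L, by nlinarith [norm_nonneg a], ?_⟩
  intro δ hδ z ζ hz hζ
  have hone : ∀ ζ : ℂ, ‖ζ‖ ≤ 1 → ‖1 - δ * ζ‖ ≤ 2 := fun ζ hζ => by
    have h := norm_sub_le 1 (δ * ζ)
    rw [norm_mul, norm_one] at h
    nlinarith [norm_nonneg δ, norm_nonneg ζ]
  have hw : ∀ z ζ : ℂ, ‖z‖ ≤ 1 → ‖ζ‖ ≤ 1 → ‖z * (1 - δ * ζ)‖ ≤ 2 := fun z ζ hz hζ => by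
    rw [norm_mul]
    nlinarith [norm_nonneg z, norm_nonneg (1 - δ * ζ), hone ζ hζ]
  constructor
  · have e : stepFactor q δ z ζ - 1 - a * z + 2 * δ * ζ = (δ * ζ) ^ 2
        + a * z * (δ * ζ * (-3 + 3 * (δ * ζ) - (δ * ζ) ^ 2))
        + (1 - δ * ζ) ^ 4 * z ^ 2 * r.eval (z * (1 - δ * ζ)) := by
      rw [hs, hpe]; ring
    have hy : ‖δ * ζ‖ ≤ ‖ζ‖ := by
      rw [norm_mul]; nlinarith [norm_nonneg ζ]
    have hy1 : ‖δ * ζ‖ ≤ 1 := hy.trans hζ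
    have b1 : ‖(δ * ζ) ^ 2‖ ≤ (‖z‖ + ‖ζ‖) ^ 2 := by
      rw [norm_pow]
      exact pow_le_pow_left₀ (norm_nonneg _) (by linarith [norm_nonneg z]) 2
    have b2' : ‖-3 + 3 * (δ * ζ) - (δ * ζ) ^ 2‖ ≤ 7 := by
      have h1 := norm_sub_le (-3 + 3 * (δ * ζ)) ((δ * ζ) ^ 2)
      have h2 := norm_add_le (-3 : ℂ) (3 * (δ * ζ))
      rw [norm_pow] at h1
      rw [norm_mul 3, norm_neg, show ‖(3 : ℂ)‖ = 3 by simp] at h2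
      nlinarith [norm_nonneg (δ * ζ)]
    have b2 : ‖a * z * (δ * ζ * (-3 + 3 * (δ * ζ) - (δ * ζ) ^ 2))‖ ≤
        7 * ‖a‖ * (‖z‖ + ‖ζ‖) ^ 2 := by
      rw [norm_mul, norm_mul a, norm_mul (δ * ζ)]
      calc ‖a‖ * ‖z‖ * (‖δ * ζ‖ * ‖-3 + 3 * (δ * ζ) - (δ * ζ) ^ 2‖)
          ≤ ‖a‖ * ‖z‖ * (‖ζ‖ * 7) := by gcongr
        _ = 7 * ‖a‖ * (‖z‖ * ‖ζ‖) := by ring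
        _ ≤ 7 * ‖a‖ * (‖z‖ + ‖ζ‖) ^ 2 := by
            gcongr; nlinarith [norm_nonneg z, norm_nonneg ζ]
    have b3 : ‖(1 - δ * ζ) ^ 4 * z ^ 2 * r.eval (z * (1 - δ * ζ))‖ ≤
        16 * R * (‖z‖ + ‖ζ‖) ^ 2 := by
      rw [norm_mul, norm_mul, norm_pow, norm_pow]
      calc ‖1 - δ * ζ‖ ^ 4 * ‖z‖ ^ 2 * ‖r.eval (z * (1 - δ * ζ))‖
          ≤ 2 ^ 4 * (‖z‖ + ‖ζ‖) ^ 2 * R := by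
            gcongr
            · exact hone ζ hζ
            · linarith [norm_nonneg ζ]
            · exact hR _ (hw z ζ hz hζ)
        _ = _ := by ring
    rw [e]
    refine (norm_add₃_le).trans ?_
    have : 0 ≤ (4 * P + 8 * L) * (‖z‖ + ‖ζ‖) ^ 2 := by positivity
    linarith
  · intro z' ζ' hz' hζ'
    have e : stepFactor q δ z ζ - stepFactor q δ z' ζ' =
        δ * (ζ' - ζ) * ((1 - δ * ζ) + (1 - δ * ζ')) * p.eval (z * (1 - δ * ζ)) +
        (1 - δ * ζ') ^ 2 * (p.eval (z * (1 - δ * ζ)) - p.eval (z' * (1 - δ * ζ'))) := by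
      rw [hs, hs]; ring
    have b1 : ‖δ * (ζ' - ζ) * ((1 - δ * ζ) + (1 - δ * ζ')) * p.eval (z * (1 - δ * ζ))‖ ≤
        4 * P * ‖ζ - ζ'‖ := by
      rw [norm_mul, norm_mul, norm_mul, norm_sub_rev ζ']
      calc ‖δ‖ * ‖ζ - ζ'‖ * ‖(1 - δ * ζ) + (1 - δ * ζ')‖ * ‖p.eval (z * (1 - δ * ζ))‖
          ≤ 1 * ‖ζ - ζ'‖ * 4 * P := by
            gcongr
            · linarith
            · exact (norm_add_le _ _).trans (by linarith [hone ζ hζ, hone ζ' hζ'])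
            · exact hP _ (hw z ζ hz hζ)
        _ = _ := by ring
    have b2 : ‖z * (1 - δ * ζ) - z' * (1 - δ * ζ')‖ ≤ 2 * (‖z - z'‖ + ‖ζ - ζ'‖) := by
      have : z * (1 - δ * ζ) - z' * (1 - δ * ζ') =
          (z - z') * (1 - δ * ζ) - z' * (δ * (ζ - ζ')) := by ring
      rw [this]
      refine (norm_sub_le _ _).trans ?_
      rw [norm_mul, norm_mul, norm_mul]
      have h1 : ‖z - z'‖ * ‖1 - δ * ζ‖ ≤ ‖z - z'‖ * 2 := by gcongr; exact hone ζ hζ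
      have h2 : ‖z'‖ * (‖δ‖ * ‖ζ - ζ'‖) ≤ 1 * (1 * ‖ζ - ζ'‖) := by
        gcongr; linarith
      linarith [norm_nonneg (ζ - ζ')]
    have b3 : ‖(1 - δ * ζ') ^ 2 * (p.eval (z * (1 - δ * ζ)) - p.eval (z' * (1 - δ * ζ')))‖ ≤
        2 ^ 2 * (L * (2 * (‖z - z'‖ + ‖ζ - ζ'‖))) := by
      rw [norm_mul, norm_pow]
      gcongr
      · exact hone ζ' hζ'
      · exact (hLip _ _ (hw z ζ hz hζ) (hw z' ζ' hz' hζ')).trans (by gcongr)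
    rw [e]
    refine (norm_add_le _ _).trans ?_
    have h1 : 0 ≤ (1 + 7 * ‖a‖ + 16 * R) * (‖z - z'‖ + ‖ζ - ζ'‖) := by positivity
    have h2 : 0 ≤ 4 * P * ‖z - z'‖ := by positivity
    nlinarith

/-- The estimates on one step of `F` near the origin in the coordinates `z` and `ζ = -x/z`. -/
structure IsStepBound (q : ℂ[X]) (r M : ℝ) : Prop where
  pos : 0 < r
  lt : r ≤ 1 / 32
  one_le : 1 ≤ M
  half_le : ∀ {δ z ζ : ℂ}, ‖δ‖ ≤ 1 / 8 → ‖z‖ ≤ r → ‖ζ‖ ≤ r →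
    1 / 2 ≤ ‖1 + z * stepFactor q δ z ζ‖
  incr_sub_one : ∀ {δ z ζ : ℂ}, ‖δ‖ ≤ 1 / 8 → ‖z‖ ≤ r → ‖ζ‖ ≤ r →
    ‖stepIncr q δ z ζ - 1‖ ≤ 1 / 4
  fiber : ∀ {δ z ζ : ℂ}, ‖δ‖ ≤ 1 / 8 → ‖z‖ ≤ r → ‖ζ‖ ≤ r →
    ‖stepFiber q δ z ζ‖ ≤ ‖ζ‖ / 4 + 2 * ‖z‖
  incr_order_two : ∀ {δ z ζ : ℂ}, ‖δ‖ ≤ 1 / 8 → ‖z‖ ≤ r → ‖ζ‖ ≤ r →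
    ‖stepIncr q δ z ζ - 1 + 2 * δ * ζ - (q.coeff 3 - 1) * z‖ ≤ M * (‖z‖ + ‖ζ‖) ^ 2
  fiber_order_two : ∀ {δ z ζ : ℂ}, ‖δ‖ ≤ 1 / 8 → ‖z‖ ≤ r → ‖ζ‖ ≤ r →
    ‖stepFiber q δ z ζ - δ * ζ - z‖ ≤ M * (‖z‖ + ‖ζ‖) ^ 2
  incr_lipschitz : ∀ {δ z ζ z' ζ' : ℂ}, ‖δ‖ ≤ 1 / 8 → ‖z‖ ≤ r → ‖ζ‖ ≤ r → ‖z'‖ ≤ r →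
    ‖ζ'‖ ≤ r → ‖stepIncr q δ z ζ - stepIncr q δ z' ζ'‖ ≤ M * (‖z - z'‖ + ‖ζ - ζ'‖)
  fiber_lipschitz : ∀ {δ z ζ z' ζ' : ℂ}, ‖δ‖ ≤ 1 / 8 → ‖z‖ ≤ r → ‖ζ‖ ≤ r → ‖z'‖ ≤ r →
    ‖ζ'‖ ≤ r → ‖stepFiber q δ z ζ - stepFiber q δ z' ζ'‖ ≤ ‖ζ - ζ'‖ / 2 + M * ‖z - z'‖

-- All estimates follow from `1 + z s` being close to `1`, where `s` is the step factor. The fibre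
-- contracts because its linear part is multiplication by the small number `δ`.
set_option maxHeartbeats 1000000 in
theorem exists_isStepBound (q : ℂ[X]) : ∃ r M : ℝ, IsStepBound q r M := by
  obtain ⟨M₁, hM₁, hb⟩ := exists_stepFactor_bounds q
  set a := q.coeff 3 with ha
  set M := M₁ + ‖a‖ + 1 with hM
  have hMa : ‖a‖ ≤ M := by linarith
  have hM1 : 1 ≤ M := by linarith [norm_nonneg a]
  have hMM : M₁ ≤ M := by linarith [norm_nonneg a]
  have hMpos : 0 < M := by linarith
  -- With `|z| + |ζ| ≤ 2r` this gives `3M(|z| + |ζ|) ≤ 1/16`, the bound for `|s - 1|`.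
  set r : ℝ := 1 / (96 * M) with hr
  have hrM : r * M = 1 / 96 := by rw [hr]; field_simp
  have hr0 : 0 < r := by positivity
  have hr1 : r ≤ 1 / 96 := by nlinarith
  have key : ∀ {δ z ζ : ℂ}, ‖δ‖ ≤ 1 / 8 → ‖z‖ ≤ r → ‖ζ‖ ≤ r →
      ‖stepFactor q δ z ζ - 1 - a * z + 2 * δ * ζ‖ ≤ M * (‖z‖ + ‖ζ‖) ^ 2 ∧
      ‖stepFactor q δ z ζ - 1‖ ≤ 3 * M * (‖z‖ + ‖ζ‖) ∧
      ‖stepFactor q δ z ζ - 1‖ ≤ 1 / 16 ∧ ‖stepFactor q δ z ζ‖ ≤ 17 / 16 ∧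
      ‖z * stepFactor q δ z ζ‖ ≤ 1 / 16 ∧ 15 / 16 ≤ ‖1 + z * stepFactor q δ z ζ‖ ∧
      ‖1 + z * stepFactor q δ z ζ‖ ≤ 17 / 16 := by
    intro δ z ζ hδ hz hζ
    have h1 := (hb δ hδ z ζ (by linarith) (by linarith)).1
    set s := stepFactor q δ z ζ
    set ρ := ‖z‖ + ‖ζ‖ with hρ
    have hρ0 : 0 ≤ ρ := by positivity
    have hρr : ρ ≤ 2 * r := by linarith
    have hMρ : M * ρ ≤ 1 / 48 := by nlinarith
    have k1 : ‖s - 1 - a * z + 2 * δ * ζ‖ ≤ M * ρ ^ 2 := h1.trans (by gcongr)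
    have k2 : ‖s - 1‖ ≤ 3 * M * ρ := by
      have e : s - 1 = (s - 1 - a * z + 2 * δ * ζ) + a * z - 2 * δ * ζ := by ring
      have n1 := norm_sub_le ((s - 1 - a * z + 2 * δ * ζ) + a * z) (2 * δ * ζ)
      have n2 := norm_add_le (s - 1 - a * z + 2 * δ * ζ) (a * z)
      rw [← e] at n1
      have n3 : ‖a * z‖ ≤ M * ‖z‖ := by rw [norm_mul]; gcongr
      have n4 : ‖2 * δ * ζ‖ ≤ M * ‖ζ‖ := by
        rw [norm_mul, norm_mul, show ‖(2 : ℂ)‖ = 2 by simp]; gcongr; linarith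
      have n5 : M * ρ ^ 2 ≤ M * ρ := by nlinarith
      have n6 : M * ρ = M * ‖z‖ + M * ‖ζ‖ := by rw [hρ]; ring
      nlinarith
    have k3 : ‖s - 1‖ ≤ 1 / 16 := by linarith
    have k4 : ‖s‖ ≤ 17 / 16 := by
      have := norm_add_le (s - 1) 1
      rw [sub_add_cancel, norm_one] at this
      linarith
    have k5 : ‖z * s‖ ≤ 1 / 16 := by
      rw [norm_mul]; nlinarith [norm_nonneg z, norm_nonneg s]
    have n1 := norm_sub_norm_le (1 : ℂ) (-(z * s))
    have n2 := norm_add_le 1 (z * s)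
    rw [norm_neg, norm_one, sub_neg_eq_add] at n1
    rw [norm_one] at n2
    exact ⟨k1, k2, k3, k4, k5, by linarith, by linarith⟩
  have hdiv2 : ∀ {n d e : ℂ}, 15 / 16 ≤ ‖d‖ → 15 / 16 ≤ ‖e‖ → ‖n / (d * e)‖ ≤ 2 * ‖n‖ := by
    intro n d e hd he
    apply norm_div_le_two_mul
    rw [norm_mul]
    nlinarith
  refine ⟨r, 60 * M, hr0, by linarith, by linarith, ?_, ?_, ?_, ?_, ?_, ?_, ?_⟩
  · intro δ z ζ hδ hz hζ
    obtain ⟨-, -, -, -, -, k, -⟩ := key hδ hz hζ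
    linarith
  · intro δ z ζ hδ hz hζ
    obtain ⟨-, -, k3, -, k5, k6, -⟩ := key hδ hz hζ
    have hne : 1 + z * stepFactor q δ z ζ ≠ 0 := norm_pos_iff.1 (by linarith)
    have e : stepIncr q δ z ζ - 1 = ((stepFactor q δ z ζ - 1) - z * stepFactor q δ z ζ) /
        (1 + z * stepFactor q δ z ζ) := by
      rw [stepIncr, eq_div_iff hne, sub_mul, div_mul_cancel₀ _ hne]; ring
    rw [e]
    refine (norm_div_le_two_mul (by linarith)).trans ?_
    linarith [norm_sub_le (stepFactor q δ z ζ - 1) (z * stepFactor q δ z ζ)]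
  · intro δ z ζ hδ hz hζ
    obtain ⟨-, -, -, k4, -, k6, -⟩ := key hδ hz hζ
    rw [stepFiber, norm_div, div_le_iff₀ (by linarith)]
    have n1 := norm_add_le (δ * ζ) (z * stepFactor q δ z ζ)
    rw [norm_mul, norm_mul] at n1
    have n2 : ‖δ‖ * ‖ζ‖ ≤ 1 / 8 * ‖ζ‖ := by gcongr
    have n3 : ‖z‖ * ‖stepFactor q δ z ζ‖ ≤ ‖z‖ * (17 / 16) := by gcongr
    have n4 : (‖ζ‖ / 4 + 2 * ‖z‖) * (15 / 16) ≤
        (‖ζ‖ / 4 + 2 * ‖z‖) * ‖1 + z * stepFactor q δ z ζ‖ := by gcongr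
    linarith [norm_nonneg z, norm_nonneg ζ]
  · intro δ z ζ hδ hz hζ
    obtain ⟨k1, k2, -, k4, -, k6, -⟩ := key hδ hz hζ
    set s := stepFactor q δ z ζ with hs
    have hne : 1 + z * s ≠ 0 := norm_pos_iff.1 (by linarith)
    have e : stepIncr q δ z ζ - 1 + 2 * δ * ζ - (a - 1) * z =
        ((s - 1 - a * z + 2 * δ * ζ) + -(z * (s - 1)) + z * s * (2 * δ * ζ - (a - 1) * z)) /
        (1 + z * s) := by
      rw [stepIncr, eq_div_iff hne, ← hs, sub_mul, add_mul, sub_mul, div_mul_cancel₀ _ hne]; ring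
    rw [e]
    refine (norm_div_le_two_mul (by linarith)).trans ?_
    set ρ := ‖z‖ + ‖ζ‖ with hρ
    have hzρ : ‖z‖ ≤ ρ := by linarith [norm_nonneg ζ]
    have hζρ : ‖ζ‖ ≤ ρ := by linarith [norm_nonneg z]
    have hρ0 : 0 ≤ ρ := by positivity
    have n1 := norm_add₃_le (a := s - 1 - a * z + 2 * δ * ζ) (b := -(z * (s - 1)))
      (c := z * s * (2 * δ * ζ - (a - 1) * z))
    have n2 : ‖-(z * (s - 1))‖ ≤ ρ * (3 * M * ρ) := by
      rw [norm_neg, norm_mul]; gcongr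
    have n3 : ‖2 * δ * ζ - (a - 1) * z‖ ≤ 1 * ρ + (M + 1) * ρ := by
      refine (norm_sub_le _ _).trans ?_
      rw [norm_mul, norm_mul, norm_mul (a - 1), show ‖(2 : ℂ)‖ = 2 by simp]
      gcongr
      · linarith
      · exact (norm_sub_le _ _).trans (by rw [norm_one]; linarith)
    have n4 : ‖z * s * (2 * δ * ζ - (a - 1) * z)‖ ≤ ρ * (17 / 16) * (1 * ρ + (M + 1) * ρ) := by
      rw [norm_mul, norm_mul]; gcongr
    nlinarith [mul_nonneg hρ0 hρ0, mul_nonneg (mul_nonneg hρ0 hρ0) (sub_nonneg.2 hM1)]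
  · intro δ z ζ hδ hz hζ
    obtain ⟨k1, k2, -, k4, -, k6, -⟩ := key hδ hz hζ
    set s := stepFactor q δ z ζ with hs
    have hne : 1 + z * s ≠ 0 := norm_pos_iff.1 (by linarith)
    have e : stepFiber q δ z ζ - δ * ζ - z =
        (z * (s - 1) - (δ * ζ + z) * (z * s)) / (1 + z * s) := by
      rw [stepFiber, eq_div_iff hne, ← hs, sub_mul, sub_mul, div_mul_cancel₀ _ hne]; ring
    rw [e]
    refine (norm_div_le_two_mul (by linarith)).trans ?_
    set ρ := ‖z‖ + ‖ζ‖ with hρ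
    have hzρ : ‖z‖ ≤ ρ := by linarith [norm_nonneg ζ]
    have hζρ : ‖ζ‖ ≤ ρ := by linarith [norm_nonneg z]
    have hρ0 : 0 ≤ ρ := by positivity
    have n1 := norm_sub_le (z * (s - 1)) ((δ * ζ + z) * (z * s))
    have n2 : ‖z * (s - 1)‖ ≤ ρ * (3 * M * ρ) := by
      rw [norm_mul]; gcongr
    have n3 : ‖δ * ζ + z‖ ≤ 1 * ρ + ρ := by
      refine (norm_add_le _ _).trans ?_
      rw [norm_mul]
      gcongr
      linarith
    have n4 : ‖(δ * ζ + z) * (z * s)‖ ≤ (1 * ρ + ρ) * (ρ * (17 / 16)) := by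
      rw [norm_mul, norm_mul z]; gcongr
    nlinarith [mul_nonneg hρ0 hρ0, mul_nonneg (mul_nonneg hρ0 hρ0) (sub_nonneg.2 hM1)]
  · intro δ z ζ z' ζ' hδ hz hζ hz' hζ'
    obtain ⟨-, -, -, k4, -, k6, k7⟩ := key hδ hz hζ
    obtain ⟨-, -, -, l4, -, l6, l7⟩ := key hδ hz' hζ'
    have hl := (hb δ hδ z ζ (by linarith) (by linarith)).2 z' ζ' (by linarith) (by linarith)
    simp only [stepIncr]
    set s := stepFactor q δ z ζ
    set s' := stepFactor q δ z' ζ'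
    have hne : 1 + z * s ≠ 0 := norm_pos_iff.1 (by linarith)
    have hne' : 1 + z' * s' ≠ 0 := norm_pos_iff.1 (by linarith)
    have e : s / (1 + z * s) - s' / (1 + z' * s') =
        ((s - s') - s * s' * (z - z')) / ((1 + z * s) * (1 + z' * s')) := by
      rw [div_sub_div _ _ hne hne']; congr 1; ring
    rw [e]
    refine (hdiv2 k6 l6).trans ?_
    have n1 := norm_sub_le (s - s') (s * s' * (z - z'))
    have n2 : ‖s * s' * (z - z')‖ ≤ 17 / 16 * (17 / 16) * ‖z - z'‖ := by
      rw [norm_mul, norm_mul]; gcongr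
    have n3 : ‖s - s'‖ ≤ M * (‖z - z'‖ + ‖ζ - ζ'‖) := hl.trans (by gcongr)
    have p1 := norm_nonneg (z - z')
    have p2 := norm_nonneg (ζ - ζ')
    nlinarith [mul_nonneg p1 (sub_nonneg.2 hM1), mul_nonneg p2 (sub_nonneg.2 hM1)]
  · intro δ z ζ z' ζ' hδ hz hζ hz' hζ'
    obtain ⟨-, -, -, k4, -, k6, k7⟩ := key hδ hz hζ
    obtain ⟨-, -, -, l4, -, l6, l7⟩ := key hδ hz' hζ'
    have hl := (hb δ hδ z ζ (by linarith) (by linarith)).2 z' ζ' (by linarith) (by linarith)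
    simp only [stepFiber]
    set s := stepFactor q δ z ζ
    set s' := stepFactor q δ z' ζ'
    have hne : 1 + z * s ≠ 0 := norm_pos_iff.1 (by linarith)
    have hne' : 1 + z' * s' ≠ 0 := norm_pos_iff.1 (by linarith)
    have e : (δ * ζ + z * s) / (1 + z * s) - (δ * ζ' + z' * s') / (1 + z' * s') =
        (δ * (ζ - ζ') * (1 + z' * s') + (1 - δ * ζ') * ((z - z') * s + z' * (s - s'))) /
        ((1 + z * s) * (1 + z' * s')) := by
      rw [div_sub_div _ _ hne hne']; congr 1; ring
    rw [e]
    refine (hdiv2 k6 l6).trans ?_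
    have p1 := norm_nonneg (z - z')
    have p2 := norm_nonneg (ζ - ζ')
    have n1 := norm_add_le (δ * (ζ - ζ') * (1 + z' * s'))
      ((1 - δ * ζ') * ((z - z') * s + z' * (s - s')))
    have n2 : ‖δ * (ζ - ζ') * (1 + z' * s')‖ ≤ 1 / 8 * ‖ζ - ζ'‖ * (17 / 16) := by
      rw [norm_mul, norm_mul]; gcongr
    have n3 : ‖s - s'‖ ≤ M * (‖z - z'‖ + ‖ζ - ζ'‖) := hl.trans (by gcongr)
    have n4 : ‖(z - z') * s + z' * (s - s')‖ ≤
        ‖z - z'‖ * (17 / 16) + r * (M * (‖z - z'‖ + ‖ζ - ζ'‖)) := by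
      refine (norm_add_le _ _).trans ?_
      rw [norm_mul, norm_mul]; gcongr
    have n5 : ‖1 - δ * ζ'‖ ≤ 2 := by
      refine (norm_sub_le _ _).trans ?_
      rw [norm_mul, norm_one]; nlinarith [norm_nonneg δ, norm_nonneg ζ']
    have n6 : ‖(1 - δ * ζ') * ((z - z') * s + z' * (s - s'))‖ ≤
        2 * (‖z - z'‖ * (17 / 16) + r * (M * (‖z - z'‖ + ‖ζ - ζ'‖))) := by
      rw [norm_mul]; gcongr
    rw [← mul_assoc r, hrM] at n6
    nlinarith [mul_nonneg p1 (sub_nonneg.2 hM1)]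

end LocalDynamics

/-! ### Approximate Fatou coordinates and the invariant cone -/

section StepCoordinates

/-- The fibre coordinate `ζ = -x/z`. -/
noncomputable def fiberCoord (p : ℂ × ℂ) : ℂ :=
  -p.2 / p.1

/-- The coordinate `-1/z - b log(-σ/z) - 2δ/(1-δ) ζ`, in which `F` is `1 + O(|z| + |ζ|)²`-close
to a translation. Here `σ` is `1` on the attracting and `-1` on the repelling side. -/
noncomputable def approxFatou (q : ℂ[X]) (σ δ : ℂ) (p : ℂ × ℂ) : ℂ :=
  -1 / p.1 - twoDimB q δ * Complex.log (σ * (-1 / p.1)) - 2 * δ / (1 - δ) * fiberCoord p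

variable {q : ℂ[X]} {r M : ℝ}

theorem norm_twoDimB_le {δ : ℂ} (hδ : ‖δ‖ ≤ 1 / 8) :
    ‖2 * δ / (1 - δ)‖ ≤ 1 ∧ ‖twoDimB q δ‖ ≤ 2 + ‖q.coeff 3‖ := by
  have h1 : 1 / 2 ≤ ‖1 - δ‖ := by
    have := norm_sub_norm_le 1 δ
    rw [norm_one] at this
    linarith
  have h2 : ‖2 * δ / (1 - δ)‖ ≤ 1 := by
    refine (norm_div_le_two_mul h1).trans ?_
    rw [norm_mul, show ‖(2 : ℂ)‖ = 2 by simp]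
    linarith
  refine ⟨h2, ?_⟩
  have e : twoDimB q δ = 1 - q.coeff 3 + 2 * δ / (1 - δ) := by rw [twoDimB]; ring
  rw [e]
  have n1 := norm_add_le (1 - q.coeff 3) (2 * δ / (1 - δ))
  have n2 := norm_sub_le 1 (q.coeff 3)
  rw [norm_one] at n2
  linarith

theorem twoDimMap_coords (h0 : q.coeff 0 = 0) (h1 : q.coeff 1 = 0) (h2 : q.coeff 2 = 1)
    (hb : IsStepBound q r M) {δ : ℂ} (hδ : ‖δ‖ ≤ 1 / 8) {p : ℂ × ℂ} (hp : p.1 ≠ 0)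
    (hz : ‖p.1‖ ≤ r) (hζ : ‖fiberCoord p‖ ≤ r) :
    (twoDimMap q δ p).1 ≠ 0 ∧
      -1 / (twoDimMap q δ p).1 = -1 / p.1 + stepIncr q δ p.1 (fiberCoord p) ∧
      fiberCoord (twoDimMap q δ p) = stepFiber q δ p.1 (fiberCoord p) := by
  have hx : p = (p.1, -(fiberCoord p * p.1)) := by
    ext
    · rfl
    · simp [fiberCoord, div_mul_cancel₀ _ hp]
  have hd := hb.half_le hδ hz hζ
  have hne : 1 + p.1 * stepFactor q δ p.1 (fiberCoord p) ≠ 0 := norm_pos_iff.1 (by linarith)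
  have e := twoDimMap_eq_stepFactor h0 h1 h2 δ p.1 (fiberCoord p)
  rw [← hx] at e
  rw [stepIncr, stepFiber]
  have e2 : fiberCoord (twoDimMap q δ p) = -(twoDimMap q δ p).2 / (twoDimMap q δ p).1 := rfl
  rw [e2, e]
  refine ⟨mul_ne_zero hp hne, ?_, ?_⟩
  · field_simp
    ring
  · field_simp

/-- Both factors lie in the right half-plane, so their arguments add up to less than `π` in modulus
and the principal logarithm is additive on them. -/
theorem norm_log_add_sub_log_sub_le {v η : ℂ} (hv : 0 < v.re) (hη : ‖η‖ ≤ 1 / 2) :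
    ‖Complex.log (v * (1 + η)) - Complex.log v - η‖ ≤ ‖η‖ ^ 2 := by
  have hv0 : v ≠ 0 := fun h => by simp [h] at hv
  have hre : 0 < (1 + η).re := by
    have := Complex.abs_re_le_norm η
    rw [Complex.add_re, Complex.one_re]
    linarith [neg_abs_le η.re]
  have hη0 : 1 + η ≠ 0 := fun h => by simp [h] at hre
  have a1 := abs_lt.1 (Complex.abs_arg_lt_pi_div_two_iff.2 (Or.inl hv))
  have a2 := abs_lt.1 (Complex.abs_arg_lt_pi_div_two_iff.2 (Or.inl hre))
  have e := (Complex.log_mul_eq_add_log_iff hv0 hη0).2 ⟨by linarith, by linarith⟩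
  rw [e, add_sub_cancel_left]
  have := Complex.norm_log_one_add_sub_self_le (z := η) (by linarith)
  refine this.trans ?_
  have h3 : (1 - ‖η‖)⁻¹ ≤ 2 := by
    rw [inv_le_comm₀ (by linarith) (by norm_num)]; linarith
  nlinarith [sq_nonneg ‖η‖]

/-- The first-order terms cancel. With `c = 2δ/(1-δ)`, the increment of `u` contributes `-2δζ +
(a-1)z`, the logarithm contributes `b_δ z`, and `-cζ` contributes `c(1-δ)ζ - cz = 2δζ - cz`. The sum
vanishes exactly when `b_δ = 1 - a + c`. -/
theorem exists_approxFatou_bound (h0 : q.coeff 0 = 0) (h1 : q.coeff 1 = 0) (h2 : q.coeff 2 = 1)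
    (hb : IsStepBound q r M) :
    ∃ K : ℝ, 0 ≤ K ∧ ∀ σ δ : ℂ, ‖δ‖ ≤ 1 / 8 → ∀ p : ℂ × ℂ, 0 < (σ * (-1 / p.1)).re →
      ‖p.1‖ ≤ r → ‖fiberCoord p‖ ≤ r →
      ‖approxFatou q σ δ (twoDimMap q δ p) - approxFatou q σ δ p - 1‖ ≤
        K * (‖p.1‖ + ‖fiberCoord p‖) ^ 2 := by
  set a := q.coeff 3 with ha
  set L : ℝ := 2 + ‖a‖ + M with hL
  have hM := hb.one_le
  have hL0 : 0 ≤ L := by positivity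
  refine ⟨2 * M + (2 + ‖a‖) * (2 + L), by positivity, ?_⟩
  intro σ δ hδ p hre hz hζ
  have hp : p.1 ≠ 0 := fun h => by simp [h] at hre
  obtain ⟨hne, hu, hf⟩ := twoDimMap_coords h0 h1 h2 hb hδ hp hz hζ
  rw [approxFatou, approxFatou, hu, hf]
  have t1 := hb.incr_sub_one hδ hz hζ
  have t2 := hb.incr_order_two hδ hz hζ
  have t3 := hb.fiber_order_two hδ hz hζ
  obtain ⟨hc, hB⟩ := norm_twoDimB_le (q := q) hδ
  have hr := hb.lt
  set z := p.1 with hz'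
  set ζ := fiberCoord p with hζ'
  set T := stepIncr q δ z ζ with hT
  set S := stepFiber q δ z ζ with hS
  set ρ := ‖z‖ + ‖ζ‖ with hρ
  have hzρ : ‖z‖ ≤ ρ := by linarith [norm_nonneg ζ]
  have hζρ : ‖ζ‖ ≤ ρ := by linarith [norm_nonneg z]
  have hρ0 : 0 ≤ ρ := by positivity
  have hT1 : ‖T - 1‖ ≤ L * ρ := by
    have e : T - 1 = (T - 1 + 2 * δ * ζ - (a - 1) * z) + -(2 * δ * ζ) + (a - 1) * z := by ring
    rw [e]
    refine norm_add₃_le.trans ?_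
    rw [norm_neg, norm_mul, norm_mul, norm_mul (a - 1), show ‖(2 : ℂ)‖ = 2 by simp]
    have n1 : 2 * ‖δ‖ * ‖ζ‖ ≤ 1 * ρ := by gcongr; linarith
    have n2 : ‖a - 1‖ * ‖z‖ ≤ (‖a‖ + 1) * ρ := by
      gcongr
      exact (norm_sub_le _ _).trans (by rw [norm_one])
    have n3 : M * ρ ^ 2 ≤ M * ρ := by
      have : ρ ≤ 1 := by linarith
      gcongr
      nlinarith
    linarith
  have hTn : ‖T‖ ≤ 5 / 4 := by
    have := norm_add_le (T - 1) 1
    rw [sub_add_cancel, norm_one] at this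
    linarith
  have hη : ‖-(z * T)‖ ≤ 5 / 4 * ‖z‖ := by
    rw [norm_neg, norm_mul]; nlinarith [norm_nonneg z]
  have hlog := norm_log_add_sub_log_sub_le hre (η := -(z * T)) (by linarith)
  -- The new argument of the logarithm is the old one times `1 - zT`, so the logarithm changes by
  -- `-z` to first order.
  have e1 : σ * (-1 / z) * (1 + -(z * T)) = σ * (-1 / z + T) := by field_simp; ring
  rw [e1] at hlog
  set l' := Complex.log (σ * (-1 / z + T))
  set l := Complex.log (σ * (-1 / z))
  have hl : ‖l' - l + z‖ ≤ (2 + L) * ρ ^ 2 := by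
    have e : l' - l + z = (l' - l - -(z * T)) + -(z * (T - 1)) := by ring
    rw [e]
    refine (norm_add_le _ _).trans ?_
    rw [norm_neg (z * (T - 1)), norm_mul]
    have n1 : ‖z‖ * ‖T - 1‖ ≤ ρ * (L * ρ) := by gcongr
    have n2 : ‖-(z * T)‖ ^ 2 ≤ (5 / 4 * ρ) ^ 2 := by
      gcongr; exact hη.trans (by gcongr)
    nlinarith [sq_nonneg ρ]
  have hδ1 : (1 : ℂ) - δ ≠ 0 := by
    intro h
    have : δ = 1 := by linear_combination -h
    rw [this, norm_one] at hδ
    norm_num at hδ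
  have e : -1 / z + T - twoDimB q δ * l' - 2 * δ / (1 - δ) * S -
      (-1 / z - twoDimB q δ * l - 2 * δ / (1 - δ) * ζ) - 1 =
      (T - 1 + 2 * δ * ζ - (a - 1) * z) + -(2 * δ / (1 - δ) * (S - δ * ζ - z)) +
        -(twoDimB q δ * (l' - l + z)) := by
    have hd : 2 * δ / (1 - δ) * (1 - δ) = 2 * δ := div_mul_cancel₀ _ hδ1
    rw [twoDimB]
    linear_combination ζ * hd
  rw [e]
  refine norm_add₃_le.trans ?_
  rw [norm_neg, norm_neg, norm_mul, norm_mul (twoDimB q δ)]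
  have m1 : ‖2 * δ / (1 - δ)‖ * ‖S - δ * ζ - z‖ ≤ 1 * (M * ρ ^ 2) := by gcongr
  have m2 : ‖twoDimB q δ‖ * ‖l' - l + z‖ ≤ (2 + ‖a‖) * ((2 + L) * ρ ^ 2) := by gcongr
  linarith

/-- The cone `|ζ| ≤ 4 |z|` is mapped into itself. -/
theorem norm_fiberCoord_twoDimMap_lt (h0 : q.coeff 0 = 0) (h1 : q.coeff 1 = 0)
    (h2 : q.coeff 2 = 1) (hb : IsStepBound q r M) {δ : ℂ} (hδ : ‖δ‖ ≤ 1 / 8) {p : ℂ × ℂ}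
    (hp : p.1 ≠ 0) (hz : ‖p.1‖ ≤ r / 4) (hζ : ‖fiberCoord p‖ ≤ 4 * ‖p.1‖) :
    ‖fiberCoord (twoDimMap q δ p)‖ < 4 * ‖(twoDimMap q δ p).1‖ := by
  have hr := hb.lt
  have hr0 := hb.pos
  have hζr : ‖fiberCoord p‖ ≤ r := by linarith
  have hzr : ‖p.1‖ ≤ r := by linarith
  obtain ⟨hne, hu, hf⟩ := twoDimMap_coords h0 h1 h2 hb hδ hp hzr hζr
  have t1 := hb.incr_sub_one hδ hzr hζr
  have t2 := hb.fiber hδ hzr hζr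
  rw [← hf] at t2
  set z' := (twoDimMap q δ p).1
  set T := stepIncr q δ p.1 (fiberCoord p)
  have e : p.1 = z' * (1 - p.1 * T) := by
    field_simp at hu
    linear_combination -hu
  have hTn : ‖T‖ ≤ 5 / 4 := by
    have := norm_add_le (T - 1) 1
    rw [sub_add_cancel, norm_one] at this
    linarith
  have hpos : 0 < ‖p.1‖ := norm_pos_iff.2 hp
  have n1 : ‖1 - p.1 * T‖ ≤ 5 / 4 := by
    refine (norm_sub_le _ _).trans ?_
    rw [norm_one, norm_mul]
    nlinarith
  -- In the cone the new `ζ` is at most `|z| + 2|z| = 3|z|`, hence at most `15/4 |z'| < 4|z'|`.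
  have n2 : ‖p.1‖ ≤ ‖z'‖ * (5 / 4) := by
    calc ‖p.1‖ = ‖z'‖ * ‖1 - p.1 * T‖ := by rw [← norm_mul, ← e]
      _ ≤ _ := by gcongr
  linarith

end StepCoordinates

/-! ### The attracting Fatou coordinate -/

section AttractingSide

variable {q : ℂ[X]} {r M : ℝ}

theorem exists_tendstoUniformlyOn_of_dist_le {α E : Type*} [NormedAddCommGroup E] [CompleteSpace E]
    {g : ℕ → α → E} {s : Set α} {u : ℕ → ℝ} (hu : Summable u)
    (h : ∀ n, ∀ x ∈ s, dist (g n x) (g (n + 1) x) ≤ u n) :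
    ∃ L : α → E, TendstoUniformlyOn g L atTop s := by
  have hlim : ∀ x ∈ s, ∃ l, Tendsto (fun n => g n x) atTop (𝓝 l) := fun x hx =>
    cauchySeq_tendsto_of_complete (cauchySeq_of_dist_le_of_summable u (fun n => h n x hx) hu)
  choose! L hL using hlim
  refine ⟨L, ?_⟩
  rw [Metric.tendstoUniformlyOn_iff]
  intro ε hε
  filter_upwards [(tendsto_sum_nat_add u).eventually (gt_mem_nhds hε)] with n hn x hx
  rw [dist_comm]
  refine lt_of_le_of_lt ?_ hn
  have := dist_le_tsum_of_dist_le_of_tendsto u (fun n => h n x hx) hu (hL x hx) n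
  simpa only [add_comm] using this

/-- Parameters and points from which the orbit stays in the attracting petal. -/
def attractingPetal (r : ℝ) : Set (ℂ × ℂ × ℂ) :=
  {y | ‖y.1‖ ≤ 1 / 8 ∧ 4 / r ≤ (-1 / y.2.1).re ∧ ‖fiberCoord y.2‖ ≤ 4 * ‖y.2.1‖}

theorem norm_le_inv_of_le_re {z : ℂ} {R : ℝ} (hR : 0 < R) (h : R ≤ (-1 / z).re) :
    z ≠ 0 ∧ ‖z‖ ≤ R⁻¹ := by
  have hz : z ≠ 0 := fun hz => by simp [hz] at h; linarith
  refine ⟨hz, ?_⟩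
  have h1 : R ≤ ‖z‖⁻¹ := by
    refine h.trans ((Complex.re_le_norm _).trans ?_)
    rw [norm_div, norm_neg, norm_one, one_div]
  exact (le_inv_comm₀ hR (norm_pos_iff.2 hz)).1 h1

/-- The increment of `-1/z` is within `1/4` of `1`, so the real part gains at least `3/4`. The
threshold `4/r` forces `|z| ≤ r/4`, hence `|ζ| ≤ r` in the cone. -/
theorem attractingPetal_step (h0 : q.coeff 0 = 0) (h1 : q.coeff 1 = 0) (h2 : q.coeff 2 = 1)
    (hb : IsStepBound q r M) {y : ℂ × ℂ × ℂ} (hy : y ∈ attractingPetal r) :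
    (y.1, twoDimMap q y.1 y.2) ∈ attractingPetal r ∧
      (-1 / y.2.1).re + 3 / 4 ≤ (-1 / (twoDimMap q y.1 y.2).1).re := by
  obtain ⟨hδ, hre, hζ⟩ := hy
  have hr := hb.lt
  have hr0 := hb.pos
  obtain ⟨hp, hz⟩ := norm_le_inv_of_le_re (by positivity) hre
  rw [inv_div] at hz
  obtain ⟨-, hu, -⟩ := twoDimMap_coords h0 h1 h2 hb hδ hp (by linarith) (by linarith)
  have hT := hb.incr_sub_one hδ (z := y.2.1) (ζ := fiberCoord y.2) (by linarith) (by linarith)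
  have hadd : (-1 / y.2.1).re + 3 / 4 ≤ (-1 / (twoDimMap q y.1 y.2).1).re := by
    rw [hu, Complex.add_re]
    have := (Complex.abs_re_le_norm _).trans hT
    rw [Complex.sub_re, Complex.one_re] at this
    linarith [neg_abs_le ((stepIncr q y.1 y.2.1 (fiberCoord y.2)).re - 1)]
  exact ⟨⟨hδ, by linarith,
    (norm_fiberCoord_twoDimMap_lt h0 h1 h2 hb hδ hp hz hζ).le⟩, hadd⟩

theorem attractingPetal_iterate (h0 : q.coeff 0 = 0) (h1 : q.coeff 1 = 0) (h2 : q.coeff 2 = 1)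
    (hb : IsStepBound q r M) {y : ℂ × ℂ × ℂ} (hy : y ∈ attractingPetal r) (n : ℕ) :
    (y.1, (twoDimMap q y.1)^[n] y.2) ∈ attractingPetal r ∧
      4 / r + 3 / 4 * n ≤ (-1 / ((twoDimMap q y.1)^[n] y.2).1).re := by
  induction n with
  | zero => exact ⟨hy, by simpa using hy.2.1⟩
  | succ n ih =>
    rw [Function.iterate_succ_apply']
    obtain ⟨k1, k2⟩ := attractingPetal_step h0 h1 h2 hb ih.1
    exact ⟨k1, by push_cast; linarith [ih.2]⟩

theorem attractingPetal_norm_le (h0 : q.coeff 0 = 0) (h1 : q.coeff 1 = 0) (h2 : q.coeff 2 = 1)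
    (hb : IsStepBound q r M) {y : ℂ × ℂ × ℂ} (hy : y ∈ attractingPetal r) (n : ℕ) :
    ‖((twoDimMap q y.1)^[n] y.2).1‖ ≤ 2 / (n + 1) ∧
      ‖fiberCoord ((twoDimMap q y.1)^[n] y.2)‖ ≤ 8 / (n + 1) ∧
      ‖((twoDimMap q y.1)^[n] y.2).2‖ ≤ 16 / (n + 1) := by
  obtain ⟨⟨_, _, k⟩, k2⟩ := attractingPetal_iterate h0 h1 h2 hb hy n
  simp only at k
  set p := (twoDimMap q y.1)^[n] y.2
  have hr := hb.lt
  have hr0 := hb.pos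
  have hn : (0 : ℝ) ≤ n := Nat.cast_nonneg n
  have h4 : 1 ≤ 4 / r := by rw [le_div_iff₀ hr0]; linarith
  obtain ⟨hp, hz⟩ := norm_le_inv_of_le_re (z := p.1) (R := (n + 1) / 2) (by positivity)
    (by linarith)
  rw [inv_div] at hz
  have e8 : 8 / ((n : ℝ) + 1) = 4 * (2 / (n + 1)) := by ring
  have hζ : ‖fiberCoord p‖ ≤ 8 / (n + 1) := by linarith
  refine ⟨hz, hζ, ?_⟩
  have e : p.2 = -(fiberCoord p * p.1) := by simp [fiberCoord, div_mul_cancel₀ _ hp]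
  have h22 : 2 / ((n : ℝ) + 1) ≤ 2 := div_le_self (by norm_num) (by linarith)
  rw [e, norm_neg, norm_mul]
  calc ‖fiberCoord p‖ * ‖p.1‖ ≤ 8 / (n + 1) * 2 := by gcongr; linarith
    _ = _ := by ring

theorem tendsto_const_div_add_one (c : ℝ) :
    Tendsto (fun n : ℕ => c / ((n : ℝ) + 1)) atTop (𝓝 0) := by
  have := (tendsto_one_div_add_atTop_nhds_zero_nat (𝕜 := ℝ)).const_mul c
  simpa only [mul_one_div, mul_zero] using this

theorem summable_const_div_add_one_sq (c : ℝ) :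
    Summable (fun n : ℕ => c / ((n : ℝ) + 1) ^ 2) := by
  have := ((summable_nat_add_iff 1).2 (Real.summable_one_div_nat_pow.2 one_lt_two)).mul_left c
  simpa only [mul_one_div, Nat.cast_add, Nat.cast_one] using this

theorem tendstoUniformlyOn_iterate_attractingPetal (h0 : q.coeff 0 = 0) (h1 : q.coeff 1 = 0)
    (h2 : q.coeff 2 = 1) (hb : IsStepBound q r M) :
    TendstoUniformlyOn (fun n (y : ℂ × ℂ × ℂ) => (twoDimMap q y.1)^[n] y.2) (fun _ => 0) atTop
      (attractingPetal r) := by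
  rw [Metric.tendstoUniformlyOn_iff]
  intro ε hε
  filter_upwards [(tendsto_const_div_add_one 16).eventually (gt_mem_nhds hε)] with n hn y hy
  obtain ⟨k1, -, k2⟩ := attractingPetal_norm_le h0 h1 h2 hb hy n
  rw [dist_comm, dist_zero_right, Prod.norm_def]
  refine max_lt (k1.trans_lt (lt_of_le_of_lt ?_ hn)) (k2.trans_lt hn)
  gcongr
  norm_num

/-- The corrected coordinate has summable errors along orbits. The correction `2δ/(1-δ) ζ` is
`O(1/n)`, so dropping it leaves the limit unchanged and recovers the approximants in terms of `z`
alone. -/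
theorem tendstoUniformlyOn_attractingPetal (h0 : q.coeff 0 = 0) (h1 : q.coeff 1 = 0)
    (h2 : q.coeff 2 = 1) (hb : IsStepBound q r M) :
    ∃ L : ℂ × ℂ × ℂ → ℂ,
      TendstoUniformlyOn (fun n (y : ℂ × ℂ × ℂ) => attractingSeq₂ q y.1 y.2 n) L atTop
        (attractingPetal r) := by
  obtain ⟨K, hK0, hK⟩ := exists_approxFatou_bound h0 h1 h2 hb
  have hr := hb.lt
  have hr0 := hb.pos
  obtain ⟨L, hL⟩ := exists_tendstoUniformlyOn_of_dist_le (s := attractingPetal r)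
    (g := fun n (y : ℂ × ℂ × ℂ) => approxFatou q 1 y.1 ((twoDimMap q y.1)^[n] y.2) - n)
    -- The factor `100` is `(2 + 8)²`, from `|z| ≤ 2/(n+1)` and `|ζ| ≤ 8/(n+1)`.
    (u := fun n : ℕ => (100 * K) / ((n : ℝ) + 1) ^ 2) (summable_const_div_add_one_sq _) (by
      intro n y hy
      obtain ⟨⟨hδ, hre, hζ⟩, -⟩ := attractingPetal_iterate h0 h1 h2 hb hy n
      obtain ⟨k1, k2, -⟩ := attractingPetal_norm_le h0 h1 h2 hb hy n
      simp only at hδ hre hζ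
      rw [dist_comm, dist_eq_norm, Function.iterate_succ_apply']
      obtain ⟨-, hz⟩ := norm_le_inv_of_le_re (by positivity) hre
      rw [inv_div] at hz
      set p := (twoDimMap q y.1)^[n] y.2
      have := hK 1 y.1 hδ p (by rw [one_mul]; exact lt_of_lt_of_le (by positivity) hre)
        (by linarith) (by linarith)
      have e : approxFatou q 1 y.1 (twoDimMap q y.1 p) - ((n + 1 : ℕ) : ℂ) -
          (approxFatou q 1 y.1 p - n) =
          approxFatou q 1 y.1 (twoDimMap q y.1 p) - approxFatou q 1 y.1 p - 1 := by
        push_cast; ring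
      rw [e]
      refine this.trans ?_
      calc K * (‖p.1‖ + ‖fiberCoord p‖) ^ 2 ≤ K * (2 / (n + 1) + 8 / (n + 1)) ^ 2 := by gcongr
        _ = _ := by field_simp; norm_num)
  refine ⟨L, ?_⟩
  rw [Metric.tendstoUniformlyOn_iff] at hL ⊢
  intro ε hε
  filter_upwards [hL (ε / 2) (by positivity),
    (tendsto_const_div_add_one 8).eventually (gt_mem_nhds (half_pos hε))] with n hn1 hn2 y hy
  obtain ⟨⟨hδ, -, -⟩, -⟩ := attractingPetal_iterate h0 h1 h2 hb hy n
  obtain ⟨-, k2, -⟩ := attractingPetal_norm_le h0 h1 h2 hb hy n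
  have hd := hn1 y hy
  have e : attractingSeq₂ q y.1 y.2 n = approxFatou q 1 y.1 ((twoDimMap q y.1)^[n] y.2) - n +
      2 * y.1 / (1 - y.1) * fiberCoord ((twoDimMap q y.1)^[n] y.2) := by
    rw [attractingSeq₂, omegaIn, approxFatou, one_mul]
    ring
  rw [e]
  refine (dist_triangle _ (approxFatou q 1 y.1 ((twoDimMap q y.1)^[n] y.2) - n) _).trans_lt ?_
  have : ‖2 * y.1 / (1 - y.1) * fiberCoord ((twoDimMap q y.1)^[n] y.2)‖ ≤ 1 * (8 / (n + 1)) := by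
    rw [norm_mul]
    gcongr
    exact (norm_twoDimB_le (q := q) hδ).1
  rw [dist_self_add_right]
  linarith

theorem differentiable_twoDimMap_iterate (q : ℂ[X]) (n : ℕ) :
    Differentiable ℂ (fun y : ℂ × ℂ × ℂ => (twoDimMap q y.1)^[n] y.2) := by
  induction n with
  | zero => exact differentiable_snd
  | succ n ih =>
    simp only [Function.iterate_succ_apply']
    have hq : Differentiable ℂ (fun z : ℂ => q.eval z) := q.differentiable
    unfold twoDimMap at ih ⊢
    fun_prop

theorem differentiableAt_twoDimB (q : ℂ[X]) {δ : ℂ} (hδ : ‖δ‖ ≤ 1 / 8) :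
    DifferentiableAt ℂ (twoDimB q) δ := by
  have : 1 - δ ≠ 0 := by
    intro h
    have : δ = 1 := by linear_combination -h
    rw [this, norm_one] at hδ
    norm_num at hδ
  unfold twoDimB
  fun_prop (disch := assumption)

theorem differentiableAt_attractingSeq₂ (q : ℂ[X]) {n : ℕ} {y : ℂ × ℂ × ℂ} (hδ : ‖y.1‖ ≤ 1 / 8)
    (hre : 0 < (-1 / ((twoDimMap q y.1)^[n] y.2).1).re) :
    DifferentiableAt ℂ (fun y : ℂ × ℂ × ℂ => attractingSeq₂ q y.1 y.2 n) y := by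
  have hp : ((twoDimMap q y.1)^[n] y.2).1 ≠ 0 := fun h => by simp [h] at hre
  have hF : DifferentiableAt ℂ (fun y : ℂ × ℂ × ℂ => ((twoDimMap q y.1)^[n] y.2).1) y :=
    ((differentiable_twoDimMap_iterate q n) y).fst
  have hB : DifferentiableAt ℂ (fun y : ℂ × ℂ × ℂ => twoDimB q y.1) y :=
    (differentiableAt_twoDimB q hδ).comp y differentiableAt_fst
  have hu : DifferentiableAt ℂ (fun y : ℂ × ℂ × ℂ => -1 / ((twoDimMap q y.1)^[n] y.2).1) y := by
    fun_prop (disch := assumption)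
  unfold attractingSeq₂ omegaIn
  exact (hu.sub (hB.mul (hu.clog (Or.inl hre)))).sub_const _

/-- Near a parameter and a point whose orbit enters the attracting petal, the attracting Fatou
coordinate is holomorphic in the parameter and the point. -/
theorem exists_ball_attractingFatou₂ (h0 : q.coeff 0 = 0) (h1 : q.coeff 1 = 0)
    (h2 : q.coeff 2 = 1) (hb : IsStepBound q r M) {N : ℕ} {y₀ : ℂ × ℂ × ℂ}
    (hy₀ : (fun y : ℂ × ℂ × ℂ => (y.1, (twoDimMap q y.1)^[N] y.2)) ⁻¹' attractingPetal r ∈ 𝓝 y₀) :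
    ∃ ε > 0, DifferentiableOn ℂ (fun y : ℂ × ℂ × ℂ => attractingFatou₂ q y.1 y.2)
        (Metric.ball y₀ ε) ∧
      ∀ y ∈ Metric.ball y₀ ε, y.2 ∈ parabolicBasin (twoDimMap q y.1) ∧
        Tendsto (attractingSeq₂ q y.1 y.2) atTop (𝓝 (attractingFatou₂ q y.1 y.2)) := by
  obtain ⟨ε, hε, hball⟩ := Metric.mem_nhds_iff.1 hy₀
  obtain ⟨L, hL⟩ := tendstoUniformlyOn_attractingPetal h0 h1 h2 hb
  set T : ℂ × ℂ × ℂ → ℂ × ℂ × ℂ := fun y => (y.1, (twoDimMap q y.1)^[N] y.2) with hT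
  have hmaps : ∀ y ∈ Metric.ball y₀ ε, T y ∈ attractingPetal r := fun y hy => hball hy
  have hseq : ∀ (y : ℂ × ℂ × ℂ) (n : ℕ), N ≤ n →
      attractingSeq₂ q y.1 y.2 n = attractingSeq₂ q (T y).1 (T y).2 (n - N) - N := by
    intro y n hn
    obtain ⟨k, rfl⟩ := Nat.exists_eq_add_of_le' hn
    rw [attractingSeq₂, attractingSeq₂, hT, Nat.add_sub_cancel, Function.iterate_add_apply]
    push_cast
    ring
  have hunif : TendstoUniformlyOn (fun n (y : ℂ × ℂ × ℂ) => attractingSeq₂ q y.1 y.2 n)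
      (fun y => L (T y) - N) atTop (Metric.ball y₀ ε) := by
    rw [Metric.tendstoUniformlyOn_iff] at hL ⊢
    intro η hη
    filter_upwards [(tendsto_sub_atTop_nat N).eventually (hL η hη), eventually_ge_atTop N]
      with n hn hnN y hy
    rw [hseq y n hnN, dist_sub_right]
    exact hn (T y) (hmaps y hy)
  have hlim : ∀ y ∈ Metric.ball y₀ ε, attractingFatou₂ q y.1 y.2 = L (T y) - N := fun y hy =>
    (hunif.tendsto_at hy).limUnder_eq
  have hdiff : ∀ᶠ n in atTop, DifferentiableOn ℂ
      (fun y : ℂ × ℂ × ℂ => attractingSeq₂ q y.1 y.2 n) (Metric.ball y₀ ε) := by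
    filter_upwards [eventually_ge_atTop N] with n hn y hy
    obtain ⟨k, rfl⟩ := Nat.exists_eq_add_of_le' hn
    obtain ⟨⟨hδ, hre, -⟩, -⟩ := attractingPetal_iterate h0 h1 h2 hb (hmaps y hy) k
    refine (differentiableAt_attractingSeq₂ q (y := y) hδ ?_).differentiableWithinAt
    rw [Function.iterate_add_apply]
    have := hb.pos
    exact lt_of_lt_of_le (by positivity) hre
  refine ⟨ε / 2, half_pos hε, ?_, fun y hy => ?_⟩
  · refine (differentiableOn_half_ball_of_tendstoUniformlyOn hε hdiff hunif).congr fun y hy => ?_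
    exact hlim y (Metric.ball_subset_ball (by linarith) hy)
  · have hy' : y ∈ Metric.ball y₀ ε := Metric.ball_subset_ball (by linarith) hy
    -- The slice of the ball at a fixed parameter is the neighbourhood on which the iterates
    -- converge uniformly.
    refine ⟨⟨(fun p => (y.1, p)) ⁻¹' Metric.ball y₀ ε, ?_, ?_⟩, ?_⟩
    · exact (Continuous.prodMk_right y.1).continuousAt.preimage_mem_nhds
        (Metric.isOpen_ball.mem_nhds hy')
    · have hit := tendstoUniformlyOn_iterate_attractingPetal h0 h1 h2 hb
      rw [Metric.tendstoUniformlyOn_iff] at hit ⊢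
      intro η hη
      filter_upwards [(tendsto_sub_atTop_nat N).eventually (hit η hη), eventually_ge_atTop N]
        with n hn hnN p hp
      obtain ⟨k, rfl⟩ := Nat.exists_eq_add_of_le' hnN
      rw [Nat.add_sub_cancel] at hn
      rw [Function.iterate_add_apply]
      exact hn _ (hmaps (y.1, p) hp)
    · rw [hlim y hy']
      exact hunif.tendsto_at hy'

end AttractingSide

/-! ### The basin of `f` and entry into the petal -/

section OneDimBasin

variable {q : ℂ[X]} {r M : ℝ}

theorem hasDerivAt_oneDimMap_iterate (h0 : q.coeff 0 = 0) (h1 : q.coeff 1 = 0) (n : ℕ) :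
    HasDerivAt (oneDimMap q)^[n] 1 0 := by
  have hq : HasDerivAt (oneDimMap q) 1 0 := by
    have e : (derivative q).eval 0 = 0 := by
      rw [← Polynomial.coeff_zero_eq_eval_zero, Polynomial.coeff_derivative]
      simp [h1]
    have := (hasDerivAt_id (0 : ℂ)).add (q.hasDerivAt 0)
    rw [e, add_zero] at this
    exact this
  have hfix : oneDimMap q 0 = 0 := by
    rw [oneDimMap, ← Polynomial.coeff_zero_eq_eval_zero, h0, add_zero]
  simpa using HasDerivAt.iterate 0 hq hfix n

theorem differentiable_oneDimMap_iterate (q : ℂ[X]) (n : ℕ) :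
    Differentiable ℂ (oneDimMap q)^[n] :=
  Differentiable.iterate (differentiable_id.add q.differentiable) n

/-- Orbits in the parabolic basin do not land on the fixed point. -/
theorem oneDimMap_iterate_ne_zero (h0 : q.coeff 0 = 0) (h1 : q.coeff 1 = 0) {z : ℂ}
    (hz : z ∈ parabolicBasin (oneDimMap q)) (N : ℕ) : (oneDimMap q)^[N] z ≠ 0 := by
  intro hN
  obtain ⟨U, hU, hunif⟩ := hz
  have han : AnalyticOnNhd ℂ (oneDimMap q)^[N] Set.univ :=
    (differentiable_oneDimMap_iterate q N).differentiableOn.analyticOnNhd isOpen_univ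
  -- By the open mapping theorem, either `f^N` is constant, against its derivative `1` at `0`, or
  -- `f^N(U)` contains a ball about `0`. In the second case the iterates of `f` tend to `0`
  -- uniformly on that ball, and the Cauchy estimate contradicts their derivative `1` at `0`.
  rcases (han z (Set.mem_univ z)).eventually_constant_or_nhds_le_map_nhds with hc | hopen
  · have hconst : (oneDimMap q)^[N] = fun _ => 0 :=
      han.eq_of_eventuallyEq analyticOnNhd_const (z₀ := z) (by
        filter_upwards [hc] with w hw
        rw [hw, hN])
    have hd := hasDerivAt_oneDimMap_iterate h0 h1 N
    rw [hconst] at hd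
    exact zero_ne_one ((hasDerivAt_const (0 : ℂ) (0 : ℂ)).unique hd)
  · rw [hN] at hopen
    obtain ⟨ε, hε, hball⟩ := Metric.mem_nhds_iff.1 (hopen (image_mem_map hU))
    rw [Metric.tendstoUniformlyOn_iff] at hunif
    obtain ⟨m, hm⟩ := eventually_atTop.1 (hunif (ε / 4) (by positivity))
    have hbd := norm_fderiv_le_of_norm_le_ball hε
      (differentiable_oneDimMap_iterate q m).differentiableOn (c := 0) (C := ε / 4)
      (fun y hy => by
        obtain ⟨w, hw, rfl⟩ := hball hy
        have := hm (m + N) (Nat.le_add_right _ _) w hw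
        rw [dist_comm, dist_zero_right, Function.iterate_add_apply] at this
        exact this.le)
    rw [← norm_deriv_eq_norm_fderiv, (hasDerivAt_oneDimMap_iterate h0 h1 m).deriv, norm_one] at hbd
    have : 2 * (ε / 4) / ε = 1 / 2 := by field_simp; norm_num
    linarith

theorem twoDimMap_zero_iterate_fst (q : ℂ[X]) (p : ℂ × ℂ) (n : ℕ) :
    ((twoDimMap q 0)^[n] p).1 = (oneDimMap q)^[n] p.1 := by
  induction n with
  | zero => rfl
  | succ n ih =>
    rw [Function.iterate_succ_apply', Function.iterate_succ_apply', ← ih]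
    simp [twoDimMap, oneDimMap]

/-- For `δ = 0`, orbits over the parabolic basin of `f` enter the attracting petal. -/
theorem exists_iterate_attractingPetal_mem_nhds (h0 : q.coeff 0 = 0) (h1 : q.coeff 1 = 0)
    (h2 : q.coeff 2 = 1) (hb : IsStepBound q r M) {p : ℂ × ℂ}
    (hp : p.1 ∈ parabolicBasin (oneDimMap q)) :
    ∃ N : ℕ, (fun y : ℂ × ℂ × ℂ => (y.1, (twoDimMap q y.1)^[N] y.2)) ⁻¹' attractingPetal r ∈
      𝓝 ((0 : ℂ), p) := by
  have hr := hb.lt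
  have hr0 := hb.pos
  have hδ : ‖(0 : ℂ)‖ ≤ 1 / 8 := by simp
  have hne := oneDimMap_iterate_ne_zero h0 h1 hp
  have hlim : Tendsto (fun n => (oneDimMap q)^[n] p.1) atTop (𝓝 0) := by
    obtain ⟨U, hU, hunif⟩ := hp
    exact hunif.tendsto_at (mem_of_mem_nhds hU)
  obtain ⟨m, hm⟩ := Metric.tendsto_atTop.1 hlim (r / 4) (by positivity)
  simp only [dist_zero_right] at hm
  have himage : ∀ z x : ℂ, twoDimMap q 0 (z, x) = twoDimMap q 0 (z, 0) := fun z x => by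
    simp [twoDimMap]
  have hfst : ∀ z x : ℂ, (twoDimMap q 0 (z, x)).1 = oneDimMap q z := fun z x => by
    simp [twoDimMap, oneDimMap]
  -- Once the orbit of `f` stays near `0`, it climbs into the petal wherever it starts; only the
  -- value `z = 0` must be excluded. As `F` at `δ = 0` ignores `x`, the step bounds may be applied
  -- with `ζ = 0`.
  have hgrow : ∀ k : ℕ, (-1 / (oneDimMap q)^[m] p.1).re + 3 / 4 * k ≤
      (-1 / (oneDimMap q)^[m + k] p.1).re := by
    intro k
    induction k with
    | zero => simp
    | succ k ih =>
      set z := (oneDimMap q)^[m + k] p.1 with hz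
      have hzr : ‖z‖ < r / 4 := hm (m + k) (Nat.le_add_right _ _)
      have hζ0 : ‖fiberCoord (z, 0)‖ ≤ r := by simp [fiberCoord, hr0.le]
      obtain ⟨-, hu, -⟩ := twoDimMap_coords h0 h1 h2 hb hδ (p := (z, 0)) (hne (m + k))
        (by simp only; linarith) hζ0
      have hT := hb.incr_sub_one hδ (z := z) (by linarith) hζ0
      rw [hfst] at hu
      rw [← add_assoc, Function.iterate_succ_apply', ← hz, hu, Complex.add_re]
      have := (Complex.abs_re_le_norm _).trans hT
      rw [Complex.sub_re, Complex.one_re] at this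
      have h3 := neg_abs_le ((stepIncr q 0 z (fiberCoord (z, 0))).re - 1)
      push_cast
      linarith
  obtain ⟨k, hk⟩ := exists_nat_gt ((4 / r - (-1 / (oneDimMap q)^[m] p.1).re) / (3 / 4))
  rw [div_lt_iff₀ (by norm_num)] at hk
  -- The additional iterate brings the point into the cone: the image of `(z, x)` is that of `(z,
  -- 0)`, which has `ζ = 0`.
  set N := m + k + 1 with hN
  have hre : 4 / r < (-1 / ((twoDimMap q 0)^[N] p).1).re := by
    have := hgrow (k + 1)
    rw [twoDimMap_zero_iterate_fst, hN, add_assoc]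
    push_cast at this
    linarith
  have hzne : ((twoDimMap q 0)^[N] p).1 ≠ 0 := by
    rw [twoDimMap_zero_iterate_fst]
    exact hne N
  have hcone : ‖fiberCoord ((twoDimMap q 0)^[N] p)‖ < 4 * ‖((twoDimMap q 0)^[N] p).1‖ := by
    rw [hN, Function.iterate_succ_apply']
    have hz1 := twoDimMap_zero_iterate_fst q p (m + k)
    set w := (twoDimMap q 0)^[m + k] p
    have hw : twoDimMap q 0 w = twoDimMap q 0 (w.1, 0) := himage w.1 w.2
    rw [hw]
    refine norm_fiberCoord_twoDimMap_lt h0 h1 h2 hb hδ ?_ ?_ (by simp [fiberCoord])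
    · rw [hz1]; exact hne _
    · rw [hz1]; exact (hm (m + k) (Nat.le_add_right _ _)).le
  refine ⟨N, ?_⟩
  -- The inequalities hold strictly at `(0, p)`, so they persist for nearby parameters and points.
  have hcont : ContinuousAt (fun y : ℂ × ℂ × ℂ => (twoDimMap q y.1)^[N] y.2) (0, p) :=
    (differentiable_twoDimMap_iterate q N).continuous.continuousAt
  have hc1 : ContinuousAt (fun y : ℂ × ℂ × ℂ => ((twoDimMap q y.1)^[N] y.2).1) (0, p) := hcont.fst
  have hc2 : ContinuousAt (fun y : ℂ × ℂ × ℂ => ((twoDimMap q y.1)^[N] y.2).2) (0, p) := hcont.snd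
  have hcre : ContinuousAt (fun y : ℂ × ℂ × ℂ => (-1 / ((twoDimMap q y.1)^[N] y.2).1).re) (0, p) :=
    Complex.continuous_re.continuousAt.comp (continuousAt_const.div hc1 hzne)
  have hcf : ContinuousAt (fun y : ℂ × ℂ × ℂ => ‖fiberCoord ((twoDimMap q y.1)^[N] y.2)‖) (0, p) :=
    (hc2.neg.div hc1 hzne).norm
  have hcδ : ContinuousAt (fun y : ℂ × ℂ × ℂ => ‖y.1‖) (0, p) := continuous_fst.norm.continuousAt
  filter_upwards [hcδ.eventually_lt (continuousAt_const (y := (1 / 8 : ℝ))) (by simp),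
    (continuousAt_const (y := 4 / r)).eventually_lt hcre hre,
    hcf.eventually_lt (continuousAt_const.mul hc1.norm) hcone] with y k1 k2 k3
  exact ⟨k1.le, k2.le, k3.le⟩

end OneDimBasin

/-! ### The inverse of the outgoing coordinate -/

section OutgoingCoordinate

theorem norm_log_sub_log_le {R : ℝ} (hR : 0 < R) {v w : ℂ} (hv : R ≤ v.re) (hw : R ≤ w.re) :
    ‖Complex.log v - Complex.log w‖ ≤ ‖v - w‖ / R := by
  have hconv : Convex ℝ {v : ℂ | R ≤ v.re} := convex_halfSpace_re_ge R
  have := hconv.norm_image_sub_le_of_norm_deriv_le (𝕜 := ℂ) (f := Complex.log) (C := R⁻¹)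
    (fun x hx => Complex.differentiableAt_log (Or.inl (hR.trans_le hx))) (fun x hx => by
      have hx0 : 0 < x.re := hR.trans_le hx
      rw [(Complex.hasDerivAt_log (Or.inl hx0)).deriv, norm_inv]
      exact inv_anti₀ hR (le_trans hx (Complex.re_le_norm x))) hw hv
  rwa [inv_mul_eq_div] at this

/-- The outgoing coordinate expands distances of `-1/z` up to the factor `1 - |b|/R`. -/
theorem norm_sub_le_omegaOut {b z w : ℂ} {R : ℝ} (hR : 0 < R) (hz : R ≤ (1 / z).re)
    (hw : R ≤ (1 / w).re) :
    ‖-1 / z - -1 / w‖ ≤ ‖omegaOut b z - omegaOut b w‖ + ‖b‖ / R * ‖-1 / z - -1 / w‖ := by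
  have h := norm_log_sub_log_le hR hz hw
  have e : -1 / z - -1 / w = (omegaOut b z - omegaOut b w) +
      b * (Complex.log (1 / z) - Complex.log (1 / w)) := by
    rw [omegaOut, omegaOut]; ring
  have e2 : ‖1 / z - 1 / w‖ = ‖-1 / z - -1 / w‖ := by
    rw [← norm_neg]; congr 1; ring
  rw [e2] at h
  calc ‖-1 / z - -1 / w‖ ≤ ‖omegaOut b z - omegaOut b w‖ +
        ‖b * (Complex.log (1 / z) - Complex.log (1 / w))‖ := by
        conv_lhs => rw [e]
        exact norm_add_le _ _
    _ ≤ ‖omegaOut b z - omegaOut b w‖ + ‖b‖ * (‖-1 / z - -1 / w‖ / R) := by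
        rw [norm_mul]; gcongr
    _ = _ := by ring

theorem omegaOut_injOn (b : ℂ) : Set.InjOn (omegaOut b) {z : ℂ | ‖b‖ + 1 < (1 / z).re} := by
  intro z hz w hw h
  have hb0 : 0 < ‖b‖ + 1 := by positivity
  have := norm_sub_le_omegaOut (b := b) hb0 (le_of_lt hz) (le_of_lt hw)
  rw [h, sub_self, norm_zero, zero_add] at this
  have hlt : ‖b‖ / (‖b‖ + 1) < 1 := by rw [div_lt_one hb0]; linarith
  have h0 : ‖-1 / z - -1 / w‖ = 0 := by nlinarith [norm_nonneg (-1 / z - -1 / w)]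
  have h1 : -1 / z = -1 / w := sub_eq_zero.1 (norm_eq_zero.1 h0)
  rw [neg_div, neg_div, neg_inj, one_div, one_div, inv_inj] at h1
  exact h1

theorem omegaOutInv_eq_of_mem {b z W : ℂ} (hz : ‖b‖ + 1 < (1 / z).re) (h : omegaOut b z = W) :
    omegaOutInv b W = z := by
  have hex : ∃ z ∈ {z : ℂ | ‖b‖ + 1 < (1 / z).re}, omegaOut b z = W := ⟨z, hz, h⟩
  exact omegaOut_injOn b (Function.invFunOn_mem hex) hz ((Function.invFunOn_eq hex).trans h.symm)

theorem exists_mul_norm_log_le (B : ℝ) (hB : 0 ≤ B) :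
    ∃ T : ℝ, ∀ v : ℂ, T ≤ ‖v‖ → B * ‖Complex.log v‖ ≤ ‖v‖ / 8 := by
  have h1 : (fun x : ℝ => B * (|Real.log x| + Real.pi)) =o[atTop] (fun x : ℝ => x) := by
    refine Asymptotics.IsLittleO.const_mul_left (Asymptotics.IsLittleO.add ?_ ?_) B
    · exact Real.isLittleO_log_id_atTop.abs_left
    · exact Asymptotics.isLittleO_const_id_atTop Real.pi
  obtain ⟨T, hT⟩ := eventually_atTop.1 (h1.bound (show (0 : ℝ) < 1 / 8 by norm_num))
  refine ⟨T, fun v hv => ?_⟩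
  have h2 := hT ‖v‖ hv
  rw [Real.norm_eq_abs, Real.norm_eq_abs, abs_norm] at h2
  have h3 : ‖Complex.log v‖ ≤ |Real.log ‖v‖| + Real.pi := by
    refine (Complex.norm_le_abs_re_add_abs_im _).trans ?_
    rw [Complex.log_re, Complex.log_im]
    gcongr
    exact Complex.abs_arg_le_pi v
  calc B * ‖Complex.log v‖ ≤ B * (|Real.log ‖v‖| + Real.pi) := by gcongr
    _ ≤ |B * (|Real.log ‖v‖| + Real.pi)| := le_abs_self _
    _ ≤ _ := by linarith

theorem re_le_of_norm_add_le {u : ℂ} {t : ℝ} (h : ‖u + t‖ ≤ t / 2) : u.re ≤ -(t / 2) := by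
  have := (Complex.re_le_norm (u + t)).trans h
  simp only [Complex.add_re, Complex.ofReal_re] at this
  linarith

/-- With `u = -1/z` the equation reads `u = W + b log(-u)`. The right side is a contraction of the
closed disc of centre `-t` and radius `t/2`, since the logarithm is small against `t` and has
derivative at most `2/t` there. All constants are uniform in `|b| ≤ B`. -/
theorem exists_omegaOutInv (B : ℝ) (hB : 0 ≤ B) :
    ∃ T : ℝ, 4 * (B + 1) ≤ T ∧ ∀ (b : ℂ) (t : ℝ) (W : ℂ), ‖b‖ ≤ B → T ≤ t → ‖W + t‖ ≤ t / 4 →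
      t / 2 ≤ (1 / omegaOutInv b W).re ∧ omegaOut b (omegaOutInv b W) = W := by
  obtain ⟨T₀, hT₀⟩ := exists_mul_norm_log_le B hB
  refine ⟨max (4 * (B + 1)) (2 * T₀), le_max_left _ _, ?_⟩
  intro b t W hb ht hW
  have ht1 : 4 * (B + 1) ≤ t := (le_max_left _ _).trans ht
  have ht2 : 2 * T₀ ≤ t := (le_max_right _ _).trans ht
  have ht0 : 0 < t := by linarith
  set φ : ℂ → ℂ := fun u => W + b * Complex.log (-u) with hφ
  set s := Metric.closedBall (-(t : ℂ)) (t / 2) with hs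
  have hmem : ∀ u, u ∈ s ↔ ‖u + t‖ ≤ t / 2 := fun u => by
    rw [hs, Metric.mem_closedBall, dist_eq_norm, sub_neg_eq_add]
  have hmaps : Set.MapsTo φ s s := by
    intro u hu
    rw [hmem] at hu ⊢
    have hre := re_le_of_norm_add_le hu
    have hlow : t / 2 ≤ ‖-u‖ := by
      have := Complex.re_le_norm (-u)
      rw [Complex.neg_re] at this
      linarith
    have hup : ‖-u‖ ≤ 3 / 2 * t := by
      have := norm_sub_le (t : ℂ) (u + t)
      rw [sub_add_cancel_right, Complex.norm_real, Real.norm_of_nonneg ht0.le] at this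
      linarith
    have hlog := hT₀ (-u) (by linarith)
    have hbl : ‖b * Complex.log (-u)‖ ≤ B * ‖Complex.log (-u)‖ := by rw [norm_mul]; gcongr
    have e : φ u + t = (W + t) + b * Complex.log (-u) := by rw [hφ]; ring
    rw [e]
    -- The bound is `t/4 + (3t/2)/8 < t/2`.
    linarith [norm_add_le (W + t) (b * Complex.log (-u))]
  have hcontr : ContractingWith (1 / 2) (hmaps.restrict φ s s) := by
    refine ⟨by rw [← NNReal.coe_lt_coe]; norm_num, LipschitzWith.of_dist_le_mul ?_⟩
    rintro ⟨u, hu⟩ ⟨v, hv⟩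
    rw [hmem] at hu hv
    have hu' := re_le_of_norm_add_le hu
    have hv' := re_le_of_norm_add_le hv
    rw [Subtype.dist_eq, Subtype.dist_eq, dist_eq_norm, dist_eq_norm]
    have h := norm_log_sub_log_le (R := t / 2) (by linarith) (v := -u) (w := -v)
      (by rw [Complex.neg_re]; linarith) (by rw [Complex.neg_re]; linarith)
    have e : (hmaps.restrict φ s s ⟨u, (hmem u).2 hu⟩ : ℂ) - hmaps.restrict φ s s ⟨v, (hmem v).2 hv⟩
        = b * (Complex.log (-u) - Complex.log (-v)) := by
      simp only [Set.MapsTo.val_restrict_apply, hφ]; ring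
    rw [e, norm_mul]
    have e2 : ‖-u - -v‖ = ‖u - v‖ := by rw [← norm_neg]; congr 1; ring
    rw [e2] at h
    calc ‖b‖ * ‖Complex.log (-u) - Complex.log (-v)‖ ≤ B * (‖u - v‖ / (t / 2)) := by gcongr
      _ = B / (t / 2) * ‖u - v‖ := by ring
      _ ≤ _ := by
        gcongr
        rw [div_le_iff₀ (by linarith)]
        norm_num
        linarith
  obtain ⟨u, hu, hfix, -⟩ := hcontr.exists_fixedPoint' Metric.isClosed_closedBall.isComplete hmaps
    (x := -(t : ℂ)) (Metric.mem_closedBall_self (by linarith)) (edist_ne_top _ _)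
  rw [hmem] at hu
  have hre := re_le_of_norm_add_le hu
  have hfix' : W + b * Complex.log (-u) = u := hfix
  have e1 : 1 / (-1 / u) = -u := by rw [one_div_div, div_neg, div_one]
  have hz : ‖b‖ + 1 < (1 / (-1 / u)).re := by rw [e1, Complex.neg_re]; linarith
  have hz2 : omegaOut b (-1 / u) = W := by
    rw [omegaOut, e1, show -1 / (-1 / u) = -(1 / (-1 / u)) by ring, e1]
    linear_combination -hfix'
  rw [omegaOutInv_eq_of_mem hz hz2, e1, Complex.neg_re]
  exact ⟨by linarith, hz2⟩

/-- The inverse of the outgoing coordinate is holomorphic in the parameter and the point. -/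
theorem differentiableAt_omegaOutInv {b W : ℂ} (hre : ‖b‖ + 1 < (1 / omegaOutInv b W).re)
    (hW : omegaOut b (omegaOutInv b W) = W) :
    DifferentiableAt ℂ (fun y : ℂ × ℂ => omegaOutInv y.1 y.2) (b, W) := by
  set z := omegaOutInv b W with hz
  set f : (ℂ × ℂ) × ℂ → ℂ := fun y => omegaOut y.1.1 y.2 - y.1.2 with hf
  set V : Set ((ℂ × ℂ) × ℂ) := {y | y.2 ≠ 0 ∧ 0 < (1 / y.2).re} with hV
  have hz0 : z ≠ 0 := fun h => by
    rw [h] at hre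
    simp only [div_zero, Complex.zero_re] at hre
    linarith [norm_nonneg b]
  have hre0 : 0 < (1 / z).re := by linarith [norm_nonneg b]
  have hre' : ContinuousAt (fun z : ℂ => (1 / z).re) z :=
    Complex.continuous_re.continuousAt.comp (continuousAt_const.div continuousAt_id hz0)
  have hVo : IsOpen V := by
    have e : V = {y | y.2 ≠ 0} ∩ {y | 0 < (1 / y.2).re} := rfl
    rw [e]
    refine ContinuousOn.isOpen_inter_preimage (f := fun y : (ℂ × ℂ) × ℂ => (1 / y.2).re)
      (t := Set.Ioi 0) ?_ (isOpen_ne_fun continuous_snd continuous_const) isOpen_Ioi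
    exact Complex.continuous_re.comp_continuousOn
      (continuousOn_const.div continuous_snd.continuousOn fun y hy => hy)
  have hfd : DifferentiableOn ℂ f V := by
    rintro y ⟨hy0, hy⟩
    have h1 : DifferentiableAt ℂ (fun y : (ℂ × ℂ) × ℂ => 1 / y.2) y := by
      fun_prop (disch := assumption)
    have h2 : DifferentiableAt ℂ (fun y : (ℂ × ℂ) × ℂ => -1 / y.2) y := by
      fun_prop (disch := assumption)
    have h3 : DifferentiableAt ℂ (fun y : (ℂ × ℂ) × ℂ => y.1.1) y := by fun_prop
    have h4 : DifferentiableAt ℂ (fun y : (ℂ × ℂ) × ℂ => y.1.2) y := by fun_prop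
    exact ((h2.sub (h3.mul (h1.clog (Or.inl hy)))).sub h4).differentiableWithinAt
  have hstrict := hasStrictFDerivAt_of_differentiableOn hVo hfd (c := ((b, W), z)) ⟨hz0, hre0⟩
  have hpart : HasDerivAt (fun w => f ((b, W), w)) ((1 + b * z) / z ^ 2) z := by
    have h1 : HasDerivAt (fun w : ℂ => 1 / w) (-(z ^ 2)⁻¹) z := by
      simpa only [one_div] using hasDerivAt_inv hz0
    have h2 := ((h1.neg.sub ((h1.clog (Or.inl hre0)).const_mul b)).sub_const W)
    have h3 : HasDerivAt (fun w : ℂ => -(1 / w) - b * Complex.log (1 / w) - W)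
        (- -(z ^ 2)⁻¹ - b * (-(z ^ 2)⁻¹ / (1 / z))) z := h2
    have e : (fun w => f ((b, W), w)) = fun w : ℂ => -(1 / w) - b * Complex.log (1 / w) - W := by
      funext w
      simp only [hf, omegaOut, neg_div]
    rw [e]
    refine h3.congr_deriv ?_
    field_simp
    ring
  -- A critical point would have `1/z = -b`, which the half-plane `Re(1/z) > |b| + 1` excludes.
  have hne : (1 + b * z) / z ^ 2 ≠ 0 := by
    refine div_ne_zero (fun h => ?_) (pow_ne_zero 2 hz0)
    have h1 : 1 / z = -b := by
      field_simp
      linear_combination h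
    rw [h1] at hre
    have := Complex.re_le_norm (-b)
    rw [norm_neg] at this
    linarith
  have hinv : (fderiv ℂ f ((b, W), z) ∘L .inr ℂ (ℂ × ℂ) ℂ).IsInvertible := by
    refine ⟨ContinuousLinearEquiv.unitsEquivAut ℂ (Units.mk0 _ hne), ?_⟩
    have h1 : HasFDerivAt (fun w => f ((b, W), w)) (fderiv ℂ f ((b, W), z) ∘L .inr ℂ (ℂ × ℂ) ℂ) z :=
      hstrict.hasFDerivAt.comp z (hasFDerivAt_prodMk_right (b, W) z)
    have h2 := h1.hasDerivAt.unique hpart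
    ext
    rw [h2]
    simp
  have hfz : f ((b, W), z) = 0 := by simp only [hf, hW, sub_self]
  have hψ := hstrict.tendsto_implicitFunctionOfProdDomain hinv
  refine (hstrict.hasStrictFDerivAt_implicitFunctionOfProdDomain hinv).differentiableAt.congr_of_eventuallyEq ?_
  have hopen : ∀ᶠ w : (ℂ × ℂ) × ℂ in 𝓝 (b, W) ×ˢ 𝓝 z, ‖w.1.1‖ + 1 < (1 / w.2).re := by
    rw [← nhds_prod_eq]
    have c1 : ContinuousAt (fun w : (ℂ × ℂ) × ℂ => ‖w.1.1‖ + 1) ((b, W), z) := by fun_prop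
    have c2 : ContinuousAt (fun w : (ℂ × ℂ) × ℂ => (1 / w.2).re) ((b, W), z) :=
      ContinuousAt.comp (f := fun w : (ℂ × ℂ) × ℂ => w.2) (x := ((b, W), z)) hre' continuousAt_snd
    exact c1.eventually_lt c2 hre
  -- Near `(b, W)` the implicit solution stays in the domain of injectivity, so it coincides with
  -- the chosen inverse.
  filter_upwards [hstrict.eventually_apply_implicitFunctionOfProdDomain hinv,
    (tendsto_id.prodMk hψ).eventually hopen] with y h1 h2
  refine omegaOutInv_eq_of_mem h2 ?_
  rw [hfz] at h1
  simpa only [hf, sub_eq_zero] using h1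

end OutgoingCoordinate

/-! ### The repelling Fatou coordinate -/

section RepellingSide

variable {q : ℂ[X]} {r M K T Y : ℝ} {N : ℕ}

/-- Constants for the analysis of the repelling side: orbits are followed until `-1/z` is about
`-N`, for Fatou coordinates of norm at most `Y`. -/
structure IsRepellingLevel (q : ℂ[X]) (r M K T Y : ℝ) (N : ℕ) : Prop where
  coeff_zero : q.coeff 0 = 0
  coeff_one : q.coeff 1 = 0
  coeff_two : q.coeff 2 = 1
  step : IsStepBound q r M
  nonneg : 0 ≤ K
  approx : ∀ σ δ : ℂ, ‖δ‖ ≤ 1 / 8 → ∀ p : ℂ × ℂ, 0 < (σ * (-1 / p.1)).re →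
    ‖p.1‖ ≤ r → ‖fiberCoord p‖ ≤ r →
    ‖approxFatou q σ δ (twoDimMap q δ p) - approxFatou q σ δ p - 1‖ ≤
      K * (‖p.1‖ + ‖fiberCoord p‖) ^ 2
  four_mul_le : 4 * ((2 + ‖q.coeff 3‖) + 1) ≤ T
  inv : ∀ (b : ℂ) (t : ℝ) (W : ℂ), ‖b‖ ≤ 2 + ‖q.coeff 3‖ → T ≤ t → ‖W + t‖ ≤ t / 4 →
    t / 2 ≤ (1 / omegaOutInv b W).re ∧ omegaOut b (omegaOutInv b W) = W
  bound_nonneg : 0 ≤ Y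
  le_level : T ≤ N
  radius_le : 16 / r ≤ N
  bound_le : 4 * (Y + 100 * K + 1) ≤ N

theorem exists_isRepellingLevel (h0 : q.coeff 0 = 0) (h1 : q.coeff 1 = 0) (h2 : q.coeff 2 = 1)
    (hY : 0 ≤ Y) : ∃ (r M K T : ℝ) (N : ℕ), IsRepellingLevel q r M K T Y N := by
  obtain ⟨r, M, hb⟩ := exists_isStepBound q
  obtain ⟨K, hK0, hK⟩ := exists_approxFatou_bound h0 h1 h2 hb
  obtain ⟨T, hT1, hT⟩ := exists_omegaOutInv (2 + ‖q.coeff 3‖) (by positivity)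
  obtain ⟨N, hN⟩ := exists_nat_ge (max T (max (16 / r) (4 * (Y + 100 * K + 1))))
  exact ⟨r, M, K, T, N, h0, h1, h2, hb, hK0, hK, hT1, hT, hY, (le_max_left _ _).trans hN,
    ((le_max_left _ _).trans (le_max_right _ _)).trans hN,
    ((le_max_right _ _).trans (le_max_right _ _)).trans hN⟩

/-- The point `p` is near the unstable direction at Fatou coordinate about `Z - t`. -/
structure IsRepellingState (q : ℂ[X]) (K : ℝ) (δ Z : ℂ) (t : ℕ) (p : ℂ × ℂ) : Prop where
  le_re : (t : ℝ) / 2 ≤ (1 / p.1).re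
  cone : ‖fiberCoord p‖ ≤ 4 * ‖p.1‖
  fatou : ‖approxFatou q (-1) δ p - (Z - t)‖ ≤ 100 * K / t

theorem approxFatou_neg_one (q : ℂ[X]) (δ : ℂ) (p : ℂ × ℂ) :
    approxFatou q (-1) δ p =
      omegaOut (twoDimB q δ) p.1 - 2 * δ / (1 - δ) * fiberCoord p := by
  rw [approxFatou, omegaOut]
  congr 4
  ring

theorem norm_le_inv_of_le_re_one_div {z : ℂ} {R : ℝ} (hR : 0 < R) (h : R ≤ (1 / z).re) :
    z ≠ 0 ∧ ‖z‖ ≤ R⁻¹ := by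
  have := norm_le_inv_of_le_re (z := -z) hR (by rwa [neg_div_neg_eq])
  rwa [neg_ne_zero, norm_neg] at this

namespace IsRepellingLevel

theorem level_ge (h : IsRepellingLevel q r M K T Y N) : (512 : ℝ) ≤ N := by
  refine le_trans ?_ h.radius_le
  rw [le_div_iff₀ h.step.pos]
  linarith [h.step.lt]

theorem state_norm_le (h : IsRepellingLevel q r M K T Y N) {δ Z : ℂ} {t : ℕ} {p : ℂ × ℂ}
    (ht : N ≤ t) (hp : IsRepellingState q K δ Z t p) :
    p.1 ≠ 0 ∧ ‖p.1‖ ≤ 2 / t ∧ ‖fiberCoord p‖ ≤ 8 / t ∧ 2 / (t : ℝ) ≤ r / 8 := by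
  have ht' : (N : ℝ) ≤ t := by exact_mod_cast ht
  have hN := h.level_ge
  have ht0 : (0 : ℝ) < t := by linarith
  obtain ⟨hne, hz⟩ := norm_le_inv_of_le_re_one_div (by positivity) hp.le_re
  rw [inv_div] at hz
  refine ⟨hne, hz, ?_, ?_⟩
  · have := hp.cone
    have e : 8 / (t : ℝ) = 4 * (2 / t) := by ring
    linarith
  · have h1 := h.radius_le.trans ht'
    have hr := h.step.pos
    rw [div_le_iff₀ hr] at h1
    rw [div_le_iff₀ ht0]
    linarith

theorem state_init (h : IsRepellingLevel q r M K T Y N) {δ Z : ℂ} (hδ : ‖δ‖ ≤ 1 / 8)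
    (hZ : ‖Z‖ ≤ Y) {n : ℕ} (hn : N ≤ n) :
    IsRepellingState q K δ Z n (omegaOutInv (twoDimB q δ) (Z - n), 0) := by
  have hn' : (N : ℝ) ≤ n := by exact_mod_cast hn
  have hK := h.nonneg
  obtain ⟨k1, k2⟩ := h.inv (twoDimB q δ) n (Z - n) (norm_twoDimB_le hδ).2 (h.le_level.trans hn')
    (by
      simp only [Complex.ofReal_natCast, sub_add_cancel]
      linarith [h.bound_le])
  refine ⟨k1, by simp [fiberCoord], ?_⟩
  rw [approxFatou_neg_one]
  simp only [k2, fiberCoord, neg_zero, zero_div, mul_zero, sub_zero, sub_self, norm_zero]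
  positivity

/-- A step may lower `Re(1/z)` by `5/4`, while `t/2` drops only by `1/2`, so the first condition
does not reproduce itself directly. The crude bound still leaves the new point in the domain of
injectivity. There its Fatou coordinate, close to `Z - t`, determines it, and the bound on the
inverse restores `t/2`. -/
theorem state_step (h : IsRepellingLevel q r M K T Y N) {δ Z : ℂ} (hδ : ‖δ‖ ≤ 1 / 8)
    (hZ : ‖Z‖ ≤ Y) {t : ℕ} (ht : N ≤ t) {p : ℂ × ℂ} (hp : IsRepellingState q K δ Z (t + 1) p) :
    IsRepellingState q K δ Z t (twoDimMap q δ p) := by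
  obtain ⟨hne, hz, hζ, hr8⟩ := h.state_norm_le (ht.trans (Nat.le_succ t)) hp
  have hre := hp.le_re
  have hfat := hp.fatou
  push_cast at hz hζ hr8 hre hfat
  have ht' : (N : ℝ) ≤ t := by exact_mod_cast ht
  have hN := h.level_ge
  have hK := h.nonneg
  have hb := h.step
  have hr := hb.lt
  have hr0 := hb.pos
  have e8 : 8 / ((t : ℝ) + 1) = 4 * (2 / (t + 1)) := by ring
  have hzr : ‖p.1‖ ≤ r := by linarith
  have hζr : ‖fiberCoord p‖ ≤ r := by linarith
  have hcone := norm_fiberCoord_twoDimMap_lt h.coeff_zero h.coeff_one h.coeff_two hb hδ hne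
    (by linarith) hp.cone
  obtain ⟨-, hu, -⟩ := twoDimMap_coords h.coeff_zero h.coeff_one h.coeff_two hb hδ hne hzr hζr
  have hT := hb.incr_sub_one hδ hzr hζr
  have happ := h.approx (-1) δ hδ p (by
    have e : (-1 : ℂ) * (-1 / p.1) = 1 / p.1 := by ring
    rw [e]; linarith) hzr hζr
  set p' := twoDimMap q δ p
  have hre' : ((t : ℝ) + 1) / 2 - 5 / 4 ≤ (1 / p'.1).re := by
    have e : 1 / p'.1 = 1 / p.1 - stepIncr q δ p.1 (fiberCoord p) := by
      linear_combination -hu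
    rw [e, Complex.sub_re]
    have := (Complex.abs_re_le_norm _).trans hT
    rw [Complex.sub_re, Complex.one_re] at this
    linarith [le_abs_self ((stepIncr q δ p.1 (fiberCoord p)).re - 1)]
  obtain ⟨-, hz'⟩ := norm_le_inv_of_le_re_one_div (R := 4) (by norm_num)
    (by linarith : (4 : ℝ) ≤ (1 / p'.1).re)
  have hfat' : ‖approxFatou q (-1) δ p' - (Z - t)‖ ≤ 100 * K / t := by
    have e : approxFatou q (-1) δ p' - (Z - t) =
        (approxFatou q (-1) δ p' - approxFatou q (-1) δ p - 1) +
          (approxFatou q (-1) δ p - (Z - (t + 1))) := by ring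
    rw [e]
    refine (norm_add_le _ _).trans ?_
    have k1 : K * (‖p.1‖ + ‖fiberCoord p‖) ^ 2 ≤ K * (2 / (t + 1) + 8 / (t + 1)) ^ 2 := by gcongr
    have k2 : K * (2 / ((t : ℝ) + 1) + 8 / (t + 1)) ^ 2 = 100 * K * (1 / ((t : ℝ) + 1) ^ 2) := by
      field_simp; norm_num
    -- This telescoping inequality is why an accumulated error of the form `100K/t` propagates.
    have k3 : 1 / ((t : ℝ) + 1) ^ 2 + 1 / (t + 1) ≤ 1 / t := by
      have ht0 : (0 : ℝ) < t := by linarith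
      rw [div_add_div _ _ (by positivity) (by positivity), div_le_div_iff₀ (by positivity) ht0]
      nlinarith
    calc _ ≤ 100 * K * (1 / ((t : ℝ) + 1) ^ 2) + 100 * K / (t + 1) := by linarith
      _ = 100 * K * (1 / ((t : ℝ) + 1) ^ 2 + 1 / (t + 1)) := by ring
      _ ≤ 100 * K * (1 / t) := by gcongr
      _ = _ := by ring
  refine ⟨?_, hcone.le, hfat'⟩
  obtain ⟨hc, hB⟩ := norm_twoDimB_le (q := q) hδ
  have h4 := h.four_mul_le
  have ha := norm_nonneg (q.coeff 3)
  have hdom : ‖twoDimB q δ‖ + 1 < (1 / p'.1).re := by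
    linarith [h.le_level]
  have hW : ‖omegaOut (twoDimB q δ) p'.1 + (t : ℝ)‖ ≤ (t : ℝ) / 4 := by
    rw [approxFatou_neg_one] at hfat'
    have e : omegaOut (twoDimB q δ) p'.1 + (t : ℝ) =
        (omegaOut (twoDimB q δ) p'.1 - 2 * δ / (1 - δ) * fiberCoord p' - (Z - t)) + Z +
          2 * δ / (1 - δ) * fiberCoord p' := by
      push_cast; ring
    rw [e]
    refine norm_add₃_le.trans ?_
    have k1 : ‖2 * δ / (1 - δ) * fiberCoord p'‖ ≤ 1 * 1 := by
      rw [norm_mul]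
      gcongr
      linarith
    have k2 : 100 * K / t ≤ 100 * K := div_le_self (by positivity) (by linarith)
    linarith [h.bound_le]
  obtain ⟨k1, -⟩ := h.inv _ t _ hB (h.le_level.trans ht') hW
  rwa [omegaOutInv_eq_of_mem hdom rfl] at k1

theorem state_iterate (h : IsRepellingLevel q r M K T Y N) {δ Z : ℂ} (hδ : ‖δ‖ ≤ 1 / 8)
    (hZ : ‖Z‖ ≤ Y) {t : ℕ} (ht : N ≤ t) (k : ℕ) {p : ℂ × ℂ}
    (hp : IsRepellingState q K δ Z (t + k) p) :
    IsRepellingState q K δ Z t ((twoDimMap q δ)^[k] p) := by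
  induction k generalizing p with
  | zero => exact hp
  | succ k ih =>
    rw [Function.iterate_succ_apply]
    exact ih (h.state_step hδ hZ (ht.trans (Nat.le_add_right _ _)) hp)

end IsRepellingLevel

/-- The distance in the coordinates `-1/z` and `ζ`, weighted so that `F` almost contracts it. -/
noncomputable def weightedDist (M : ℝ) (p p' : ℂ × ℂ) : ℝ :=
  ‖-1 / p.1 - -1 / p'.1‖ + 2 * M * ‖fiberCoord p - fiberCoord p'‖

namespace IsRepellingLevel

/-- Both approximate Fatou coordinates are within `100K/t` of `Z - t`, and both `ζ` are at most
`8/t`. As `|b_δ|/(t/2) ≤ 1/2`, the outgoing coordinate shrinks distances of `-1/z` at most by a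
factor `2`. -/
theorem weightedDist_le (h : IsRepellingLevel q r M K T Y N) {δ Z : ℂ} (hδ : ‖δ‖ ≤ 1 / 8)
    {t : ℕ} (ht : N ≤ t) {p p' : ℂ × ℂ} (hp : IsRepellingState q K δ Z t p)
    (hp' : IsRepellingState q K δ Z t p') :
    weightedDist M p p' ≤ (400 * K + 32 + 32 * M) / t := by
  obtain ⟨-, -, hζ, -⟩ := h.state_norm_le ht hp
  obtain ⟨-, -, hζ', -⟩ := h.state_norm_le ht hp'
  obtain ⟨hc, hB⟩ := norm_twoDimB_le (q := q) hδ
  have ht' : (N : ℝ) ≤ t := by exact_mod_cast ht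
  have hN := h.level_ge
  have ht0 : (0 : ℝ) < t := by linarith
  have hexp := norm_sub_le_omegaOut (b := twoDimB q δ) (by positivity) hp.le_re hp'.le_re
  have hhalf : ‖twoDimB q δ‖ / ((t : ℝ) / 2) ≤ 1 / 2 := by
    rw [div_le_iff₀ (by positivity)]
    linarith [h.le_level, h.four_mul_le]
  have hω : ‖omegaOut (twoDimB q δ) p.1 - omegaOut (twoDimB q δ) p'.1‖ ≤
      200 * K / t + 16 / t := by
    have e : omegaOut (twoDimB q δ) p.1 - omegaOut (twoDimB q δ) p'.1 =
        (approxFatou q (-1) δ p - (Z - t)) + -(approxFatou q (-1) δ p' - (Z - t)) +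
          2 * δ / (1 - δ) * (fiberCoord p - fiberCoord p') := by
      rw [approxFatou_neg_one, approxFatou_neg_one]; ring
    rw [e]
    refine norm_add₃_le.trans ?_
    rw [norm_neg, norm_mul]
    have k1 : ‖2 * δ / (1 - δ)‖ * ‖fiberCoord p - fiberCoord p'‖ ≤ 1 * (8 / t + 8 / t) := by
      gcongr
      exact (norm_sub_le _ _).trans (by linarith)
    have k2 := hp.fatou
    have k3 := hp'.fatou
    have e1 : 200 * K / (t : ℝ) = 100 * K / t + 100 * K / t := by ring
    have e2 : 16 / (t : ℝ) = 8 / t + 8 / t := by ring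
    linarith
  have hΔ : ‖-1 / p.1 - -1 / p'.1‖ ≤ 2 * (200 * K / t + 16 / t) := by
    have : ‖twoDimB q δ‖ / ((t : ℝ) / 2) * ‖-1 / p.1 - -1 / p'.1‖ ≤
        1 / 2 * ‖-1 / p.1 - -1 / p'.1‖ := by gcongr
    linarith
  have hM := h.step.one_le
  have hζζ : 2 * M * ‖fiberCoord p - fiberCoord p'‖ ≤ 2 * M * (8 / t + 8 / t) := by
    gcongr
    exact (norm_sub_le _ _).trans (by linarith)
  rw [weightedDist]
  calc _ ≤ 2 * (200 * K / t + 16 / t) + 2 * M * (8 / t + 8 / t) := add_le_add hΔ hζζ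
    _ = _ := by ring

/-- The weight `2M` balances the coupling: a difference `X` of the `ζ` adds `MX` to the first term,
while the halving of the fibre releases exactly `MX` from the second. What is left is at most `3M²|z
- z'|`, and `|z - z'|` is at most `4/t²` times the difference of the `-1/z`. -/
theorem weightedDist_step (h : IsRepellingLevel q r M K T Y N) {δ Z : ℂ} (hδ : ‖δ‖ ≤ 1 / 8)
    {t : ℕ} (ht : N ≤ t) {p p' : ℂ × ℂ} (hp : IsRepellingState q K δ Z t p)
    (hp' : IsRepellingState q K δ Z t p') :
    weightedDist M (twoDimMap q δ p) (twoDimMap q δ p') ≤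
      (1 + 12 * M ^ 2 / t ^ 2) * weightedDist M p p' := by
  obtain ⟨hne, hz, hζ, hr8⟩ := h.state_norm_le ht hp
  obtain ⟨hne', hz', hζ', -⟩ := h.state_norm_le ht hp'
  have hb := h.step
  have hr := hb.lt
  have hr0 := hb.pos
  have hM := hb.one_le
  have e8 : 8 / (t : ℝ) = 4 * (2 / t) := by ring
  obtain ⟨-, hu, hf⟩ := twoDimMap_coords h.coeff_zero h.coeff_one h.coeff_two hb hδ hne
    (by linarith) (by linarith)
  obtain ⟨-, hu', hf'⟩ := twoDimMap_coords h.coeff_zero h.coeff_one h.coeff_two hb hδ hne'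
    (by linarith) (by linarith)
  have l1 := hb.incr_lipschitz hδ (z := p.1) (ζ := fiberCoord p) (z' := p'.1)
    (ζ' := fiberCoord p') (by linarith) (by linarith) (by linarith) (by linarith)
  have l2 := hb.fiber_lipschitz hδ (z := p.1) (ζ := fiberCoord p) (z' := p'.1)
    (ζ' := fiberCoord p') (by linarith) (by linarith) (by linarith) (by linarith)
  rw [weightedDist, weightedDist, hu, hu', hf, hf']
  have hΔz : ‖p.1 - p'.1‖ ≤ 4 / t ^ 2 * ‖-1 / p.1 - -1 / p'.1‖ := by
    have e : p.1 - p'.1 = p.1 * p'.1 * (-1 / p.1 - -1 / p'.1) := by field_simp; ring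
    calc ‖p.1 - p'.1‖ = ‖p.1‖ * ‖p'.1‖ * ‖-1 / p.1 - -1 / p'.1‖ := by
          rw [← norm_mul, ← norm_mul, ← e]
      _ ≤ 2 / t * (2 / t) * ‖-1 / p.1 - -1 / p'.1‖ := by gcongr
      _ = _ := by ring
  have n1 : ‖-1 / p.1 + stepIncr q δ p.1 (fiberCoord p) -
      (-1 / p'.1 + stepIncr q δ p'.1 (fiberCoord p'))‖ ≤ ‖-1 / p.1 - -1 / p'.1‖ +
        ‖stepIncr q δ p.1 (fiberCoord p) - stepIncr q δ p'.1 (fiberCoord p')‖ := by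
    rw [add_sub_add_comm]
    exact norm_add_le _ _
  set U := ‖-1 / p.1 - -1 / p'.1‖ with hU
  set X := ‖fiberCoord p - fiberCoord p'‖ with hX
  set A := ‖p.1 - p'.1‖ with hA
  have hU0 : 0 ≤ U := norm_nonneg _
  have hX0 : 0 ≤ X := norm_nonneg _
  have hA0 : 0 ≤ A := norm_nonneg _
  have n2 : 2 * M * ‖stepFiber q δ p.1 (fiberCoord p) - stepFiber q δ p'.1 (fiberCoord p')‖ ≤
      2 * M * (X / 2 + M * A) := by gcongr
  have n3 : M * A + 2 * M ^ 2 * A ≤ 3 * M ^ 2 * A := by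
    have : M ≤ M ^ 2 := by nlinarith
    nlinarith
  have n4 : 3 * M ^ 2 * A ≤ 3 * M ^ 2 * (4 / t ^ 2 * U) := by gcongr
  have n5 : 3 * M ^ 2 * (4 / t ^ 2 * U) = 12 * M ^ 2 / t ^ 2 * U := by ring
  have n6 : 0 ≤ 12 * M ^ 2 / (t : ℝ) ^ 2 * (2 * M * X) := by positivity
  nlinarith

theorem weightedDist_iterate (h : IsRepellingLevel q r M K T Y N) {δ Z : ℂ} (hδ : ‖δ‖ ≤ 1 / 8)
    (hZ : ‖Z‖ ≤ Y) {t : ℕ} (ht : N ≤ t) (k : ℕ) {p p' : ℂ × ℂ}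
    (hp : IsRepellingState q K δ Z (t + k) p) (hp' : IsRepellingState q K δ Z (t + k) p') :
    weightedDist M ((twoDimMap q δ)^[k] p) ((twoDimMap q δ)^[k] p') ≤
      Real.exp (12 * M ^ 2 / t) * weightedDist M p p' := by
  have hM := h.step.one_le
  have hD0 : ∀ p p', 0 ≤ weightedDist M p p' := fun p p' => by
    rw [weightedDist]; positivity
  induction k generalizing t with
  | zero =>
    have : 1 ≤ Real.exp (12 * M ^ 2 / t) := Real.one_le_exp (by positivity)
    exact le_mul_of_one_le_left (hD0 _ _) this
  | succ k ih =>
    rw [Function.iterate_succ_apply', Function.iterate_succ_apply']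
    have e : t + (k + 1) = t + 1 + k := by ring
    rw [e] at hp hp'
    have ht1 : N ≤ t + 1 := ht.trans (Nat.le_succ t)
    have s := h.state_iterate hδ hZ ht1 k hp
    have s' := h.state_iterate hδ hZ ht1 k hp'
    refine (h.weightedDist_step hδ ht1 s s').trans ?_
    have ht' : (N : ℝ) ≤ t := by exact_mod_cast ht
    have ht0 : (0 : ℝ) < t := by linarith [h.level_ge]
    have k3 : 1 / ((t : ℝ) + 1) ^ 2 + 1 / (t + 1) ≤ 1 / t := by
      rw [div_add_div _ _ (by positivity) (by positivity), div_le_div_iff₀ (by positivity) ht0]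
      nlinarith
    -- The same telescoping in the exponent bounds the product of the growth factors independently
    -- of the number of steps.
    have hexp : (1 + 12 * M ^ 2 / ((t + 1 : ℕ) : ℝ) ^ 2) * Real.exp (12 * M ^ 2 / (t + 1 : ℕ)) ≤
        Real.exp (12 * M ^ 2 / t) := by
      calc _ ≤ Real.exp (12 * M ^ 2 / ((t + 1 : ℕ) : ℝ) ^ 2) *
            Real.exp (12 * M ^ 2 / (t + 1 : ℕ)) := by
            gcongr
            rw [add_comm]
            exact Real.add_one_le_exp _
        _ = Real.exp (12 * M ^ 2 * (1 / ((t : ℝ) + 1) ^ 2 + 1 / (t + 1))) := by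
            rw [← Real.exp_add]; congr 1; push_cast; ring
        _ ≤ Real.exp (12 * M ^ 2 * (1 / t)) := by gcongr
        _ = _ := by rw [mul_one_div]
    calc _ ≤ (1 + 12 * M ^ 2 / ((t + 1 : ℕ) : ℝ) ^ 2) *
          (Real.exp (12 * M ^ 2 / (t + 1 : ℕ)) * weightedDist M p p') := by
          gcongr
          exact ih ht1 hp hp'
      _ = (1 + 12 * M ^ 2 / ((t + 1 : ℕ) : ℝ) ^ 2) * Real.exp (12 * M ^ 2 / (t + 1 : ℕ)) *
          weightedDist M p p' := by ring
      _ ≤ _ := mul_le_mul_of_nonneg_right hexp (hD0 _ _)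

/-- Points at the last level lie in the unit polydisc, where `weightedDist` dominates the
distance. -/
theorem dist_le_weightedDist (h : IsRepellingLevel q r M K T Y N) {δ Z : ℂ} {p p' : ℂ × ℂ}
    (hp : IsRepellingState q K δ Z N p) (hp' : IsRepellingState q K δ Z N p') :
    ‖p‖ ≤ 1 ∧ dist p p' ≤ weightedDist M p p' := by
  obtain ⟨hne, hz, hζ, hr8⟩ := h.state_norm_le le_rfl hp
  obtain ⟨hne', hz', hζ', -⟩ := h.state_norm_le le_rfl hp'
  have hr := h.step.lt
  have hM := h.step.one_le
  have e8 : 8 / (N : ℝ) = 4 * (2 / N) := by ring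
  have z1 : ‖p.1‖ ≤ 1 := by linarith
  have z1' : ‖p'.1‖ ≤ 1 := by linarith
  have f1 : ‖fiberCoord p‖ ≤ 1 := by linarith
  have hx : ∀ {p : ℂ × ℂ}, p.1 ≠ 0 → p.2 = -(fiberCoord p * p.1) := fun hp => by
    simp [fiberCoord, div_mul_cancel₀ _ hp]
  have hΔz : ‖p.1 - p'.1‖ ≤ ‖-1 / p.1 - -1 / p'.1‖ := by
    have e : p.1 - p'.1 = p.1 * p'.1 * (-1 / p.1 - -1 / p'.1) := by field_simp; ring
    calc ‖p.1 - p'.1‖ = ‖p.1‖ * ‖p'.1‖ * ‖-1 / p.1 - -1 / p'.1‖ := by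
          rw [← norm_mul, ← norm_mul, ← e]
      _ ≤ 1 * 1 * ‖-1 / p.1 - -1 / p'.1‖ := by gcongr
      _ = _ := by ring
  have hζM : ‖fiberCoord p - fiberCoord p'‖ ≤ 2 * M * ‖fiberCoord p - fiberCoord p'‖ :=
    le_mul_of_one_le_left (norm_nonneg _) (by linarith)
  rw [weightedDist, dist_eq_norm, Prod.norm_def, Prod.norm_def]
  refine ⟨max_le z1 ?_, max_le ?_ ?_⟩
  · rw [hx hne, norm_neg, norm_mul]
    nlinarith [norm_nonneg p.1, norm_nonneg (fiberCoord p)]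
  · rw [Prod.fst_sub]
    linarith [norm_nonneg (fiberCoord p - fiberCoord p')]
  · have e : p.2 - p'.2 = -(fiberCoord p * (p.1 - p'.1) + (fiberCoord p - fiberCoord p') * p'.1) := by
      rw [hx hne, hx hne']; ring
    rw [Prod.snd_sub, e, norm_neg]
    refine (norm_add_le _ _).trans ?_
    rw [norm_mul, norm_mul]
    have m1 : ‖fiberCoord p‖ * ‖p.1 - p'.1‖ ≤ 1 * ‖p.1 - p'.1‖ := by gcongr
    have m2 : ‖fiberCoord p - fiberCoord p'‖ * ‖p'.1‖ ≤ ‖fiberCoord p - fiberCoord p'‖ * 1 := by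
      gcongr
    linarith

/-- All orbits are stopped `N` steps early, at level `N`, inside the unit polydisc. The remaining
iterate `F^N` is uniformly continuous there jointly with `δ`, so closeness at level `N` is enough.
-/
theorem uniformCauchySeqOn_repellingSeq₂ (h : IsRepellingLevel q r M K T Y N) :
    UniformCauchySeqOn (fun n (y : ℂ × ℂ) => repellingSeq₂ q y.1 y.2 n) atTop
      {y | ‖y.1‖ ≤ 1 / 8 ∧ ‖y.2‖ ≤ Y} := by
  have huc := (isCompact_closedBall (0 : ℂ × ℂ × ℂ) 1).uniformContinuousOn_of_continuous
    (differentiable_twoDimMap_iterate q N).continuous.continuousOn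
  rw [Metric.uniformContinuousOn_iff] at huc
  have hM := h.step.one_le
  have hK := h.nonneg
  set C := Real.exp (12 * M ^ 2 / N) * (400 * K + 32 + 32 * M) with hC
  have hseq : ∀ (δ Z : ℂ) (n : ℕ), N ≤ n → repellingSeq₂ q δ Z n = (twoDimMap q δ)^[N]
      ((twoDimMap q δ)^[n - N] (omegaOutInv (twoDimB q δ) (Z - n), 0)) := by
    intro δ Z n hn
    rw [← Function.iterate_add_apply, Nat.add_sub_cancel' hn, repellingSeq₂]
  have hlev : ∀ {δ Z : ℂ}, ‖δ‖ ≤ 1 / 8 → ‖Z‖ ≤ Y → ∀ {m n : ℕ}, N ≤ m → m ≤ n →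
      ‖(twoDimMap q δ)^[n - N] (omegaOutInv (twoDimB q δ) (Z - n), 0)‖ ≤ 1 ∧
      dist ((twoDimMap q δ)^[n - N] (omegaOutInv (twoDimB q δ) (Z - n), 0))
        ((twoDimMap q δ)^[m - N] (omegaOutInv (twoDimB q δ) (Z - m), 0)) ≤ C / m := by
    intro δ Z hδ hZ m n hm hmn
    have i1 := h.state_init hδ hZ hm
    -- After `n - m` steps the orbit started at level `n` is at level `m`, together with the
    -- starting point of index `m`.
    have i2 := h.state_iterate hδ hZ hm (n - m) (p := (omegaOutInv (twoDimB q δ) (Z - n), 0))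
      (by rw [Nat.add_sub_cancel' hmn]; exact h.state_init hδ hZ (hm.trans hmn))
    have e : n - N = (m - N) + (n - m) := by omega
    rw [e, Function.iterate_add_apply]
    set p := (twoDimMap q δ)^[n - m] (omegaOutInv (twoDimB q δ) (Z - n), 0)
    set p' : ℂ × ℂ := (omegaOutInv (twoDimB q δ) (Z - m), 0)
    have i1' : IsRepellingState q K δ Z (N + (m - N)) p' := by rwa [Nat.add_sub_cancel' hm]
    have i2' : IsRepellingState q K δ Z (N + (m - N)) p := by rwa [Nat.add_sub_cancel' hm]
    obtain ⟨k1, k2⟩ := h.dist_le_weightedDist (h.state_iterate hδ hZ le_rfl _ i2')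
      (h.state_iterate hδ hZ le_rfl _ i1')
    refine ⟨k1, k2.trans ((h.weightedDist_iterate hδ hZ le_rfl _ i2' i1').trans ?_)⟩
    calc _ ≤ Real.exp (12 * M ^ 2 / N) * ((400 * K + 32 + 32 * M) / m) := by
          gcongr
          exact h.weightedDist_le hδ hm i2 i1
      _ = C / m := by rw [hC]; ring
  have hclose : ∀ ε > 0, ∃ m : ℕ, ∀ n ≥ m, ∀ y ∈ {y : ℂ × ℂ | ‖y.1‖ ≤ 1 / 8 ∧ ‖y.2‖ ≤ Y},
      dist (repellingSeq₂ q y.1 y.2 n) (repellingSeq₂ q y.1 y.2 m) < ε := by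
    intro ε hε
    obtain ⟨η, hη, hηε⟩ := huc ε hε
    obtain ⟨m, hm1, hm2⟩ := ((tendsto_const_div_atTop_nhds_zero_nat C).eventually
      (gt_mem_nhds hη)).and (eventually_ge_atTop N) |>.exists
    refine ⟨m, fun n hn y hy => ?_⟩
    obtain ⟨hδ, hZ⟩ := hy
    obtain ⟨k1, k2⟩ := hlev hδ hZ hm2 hn
    obtain ⟨l1, -⟩ := hlev hδ hZ hm2 le_rfl
    rw [hseq _ _ n (hm2.trans hn), hseq _ _ m hm2]
    refine hηε (y.1, _) ?_ (y.1, _) ?_ ?_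
    · rw [mem_closedBall_zero_iff, Prod.norm_def]
      exact max_le (by simp only; linarith) k1
    · rw [mem_closedBall_zero_iff, Prod.norm_def]
      exact max_le (by simp only; linarith) l1
    · rw [dist_prod_same_left]
      exact k2.trans_lt hm1
  rw [Metric.uniformCauchySeqOn_iff]
  intro ε hε
  obtain ⟨m, hm⟩ := hclose (ε / 2) (half_pos hε)
  refine ⟨m, fun i hi j hj y hy => ?_⟩
  have := dist_triangle_right (repellingSeq₂ q y.1 y.2 i) (repellingSeq₂ q y.1 y.2 j)
    (repellingSeq₂ q y.1 y.2 m)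
  linarith [hm i hi y hy, hm j hj y hy]

theorem differentiableAt_repellingSeq₂ (h : IsRepellingLevel q r M K T Y N) {y : ℂ × ℂ}
    (hδ : ‖y.1‖ ≤ 1 / 8) (hZ : ‖y.2‖ ≤ Y) {n : ℕ} (hn : N ≤ n) :
    DifferentiableAt ℂ (fun y : ℂ × ℂ => repellingSeq₂ q y.1 y.2 n) y := by
  have hn' : (N : ℝ) ≤ n := by exact_mod_cast hn
  have hK := h.nonneg
  obtain ⟨-, hB⟩ := norm_twoDimB_le (q := q) hδ
  obtain ⟨k1, k2⟩ := h.inv (twoDimB q y.1) n (y.2 - n) hB (h.le_level.trans hn')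
    (by
      simp only [Complex.ofReal_natCast, sub_add_cancel]
      linarith [h.bound_le])
  have hdom : ‖twoDimB q y.1‖ + 1 < (1 / omegaOutInv (twoDimB q y.1) (y.2 - n)).re := by
    have ha := norm_nonneg (q.coeff 3)
    linarith [h.le_level, h.four_mul_le]
  have hB' : DifferentiableAt ℂ (fun y : ℂ × ℂ => twoDimB q y.1) y :=
    (differentiableAt_twoDimB q hδ).comp y differentiableAt_fst
  have hinv : DifferentiableAt ℂ (fun y : ℂ × ℂ => omegaOutInv (twoDimB q y.1) (y.2 - n)) y :=
    DifferentiableAt.comp (f := fun y : ℂ × ℂ => (twoDimB q y.1, y.2 - (n : ℂ))) y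
      (differentiableAt_omegaOutInv hdom k2) (hB'.prodMk (differentiableAt_snd.sub_const _))
  exact DifferentiableAt.comp
    (f := fun y : ℂ × ℂ => (y.1, (omegaOutInv (twoDimB q y.1) (y.2 - n), (0 : ℂ)))) y
    (differentiable_twoDimMap_iterate q n _)
    (differentiableAt_fst.prodMk (hinv.prodMk (differentiableAt_const _)))

end IsRepellingLevel

/-- Near `δ = 0`, the repelling Fatou coordinate is holomorphic in the parameter and the point. -/
theorem exists_ball_repellingFatou₂ (h0 : q.coeff 0 = 0) (h1 : q.coeff 1 = 0)
    (h2 : q.coeff 2 = 1) (Z₀ : ℂ) :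
    ∃ ε > 0, DifferentiableOn ℂ (fun y : ℂ × ℂ => repellingFatou₂ q y.1 y.2)
        (Metric.ball (0, Z₀) ε) ∧
      ∀ y ∈ Metric.ball (0, Z₀) ε,
        Tendsto (repellingSeq₂ q y.1 y.2) atTop (𝓝 (repellingFatou₂ q y.1 y.2)) := by
  obtain ⟨r, M, K, T, N, h⟩ := exists_isRepellingLevel h0 h1 h2 (Y := ‖Z₀‖ + 1) (by positivity)
  have hsub : ∀ y ∈ Metric.ball ((0 : ℂ), Z₀) (1 / 8), ‖y.1‖ ≤ 1 / 8 ∧ ‖y.2‖ ≤ ‖Z₀‖ + 1 := by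
    intro y hy
    rw [Metric.mem_ball, Prod.dist_eq, max_lt_iff, dist_zero_right, dist_eq_norm] at hy
    refine ⟨hy.1.le, ?_⟩
    linarith [norm_sub_norm_le y.2 Z₀, hy.2]
  have hcau := h.uniformCauchySeqOn_repellingSeq₂.mono hsub
  have hlim : ∀ y ∈ Metric.ball ((0 : ℂ), Z₀) (1 / 8),
      Tendsto (repellingSeq₂ q y.1 y.2) atTop (𝓝 (repellingFatou₂ q y.1 y.2)) := by
    intro y hy
    obtain ⟨l, hl⟩ := cauchySeq_tendsto_of_complete (hcau.cauchySeq hy)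
    have : repellingFatou₂ q y.1 y.2 = l := hl.limUnder_eq
    rw [this]
    exact hl
  refine ⟨1 / 8 / 2, by norm_num, ?_, fun y hy => hlim y (Metric.ball_subset_ball (by norm_num) hy)⟩
  refine differentiableOn_half_ball_of_tendstoUniformlyOn (by norm_num) ?_
    (hcau.tendstoUniformlyOn_of_tendsto hlim)
  filter_upwards [eventually_ge_atTop N] with n hn y hy
  exact (h.differentiableAt_repellingSeq₂ (hsub y hy).1 (hsub y hy).2 hn).differentiableWithinAt

end RepellingSide

/-! ### Comparison at `δ = 0` and persistence of the fixed point -/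

section LavaursMaps

variable {q : ℂ[X]}

theorem attractingFatou₂_zero (q : ℂ[X]) (p : ℂ × ℂ) :
    attractingFatou₂ q 0 p = attractingFatou₁ q p.1 := by
  rw [attractingFatou₂, attractingFatou₁]
  congr 1
  funext n
  rw [attractingSeq₂, attractingSeq₁, twoDimMap_zero_iterate_fst, twoDimB, oneDimB]
  simp

/-- Convergence is assumed because `limUnder` commutes with the projection only when the limit
exists. -/
theorem repellingFatou₁_eq (q : ℂ[X]) {Z : ℂ}
    (h : Tendsto (repellingSeq₂ q 0 Z) atTop (𝓝 (repellingFatou₂ q 0 Z))) :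
    repellingFatou₁ q Z = (repellingFatou₂ q 0 Z).1 := by
  have e : repellingSeq₁ q Z = fun n => (repellingSeq₂ q 0 Z n).1 := by
    funext n
    rw [repellingSeq₂, repellingSeq₁, twoDimMap_zero_iterate_fst, twoDimB, oneDimB]
    simp
  rw [repellingFatou₁, e]
  exact ((continuous_fst.tendsto _).comp h).limUnder_eq

theorem isInvertible_of_apply_one_ne_zero {A : ℂ →L[ℂ] ℂ} (h : A 1 ≠ 0) : A.IsInvertible := by
  refine ⟨ContinuousLinearEquiv.unitsEquivAut ℂ (Units.mk0 _ h), ?_⟩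
  ext
  simp

/-- The nonzero eigenvalue of a composition `E → ℂ → E` is the scalar `Φ (Ψ 1)`. -/
theorem norm_lt_one_of_hasEigenvalue_comp {E : Type*} [NormedAddCommGroup E] [NormedSpace ℂ E]
    {Φ : E →L[ℂ] ℂ} {Ψ : ℂ →L[ℂ] E} (h : ‖Φ (Ψ 1)‖ < 1) {μ : ℂ}
    (hμ : Module.End.HasEigenvalue ((Ψ ∘L Φ : E →L[ℂ] E) : E →ₗ[ℂ] E) μ) : ‖μ‖ < 1 := by
  obtain ⟨v, hv⟩ := hμ.exists_hasEigenvector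
  have hv1 : Ψ (Φ v) = μ • v := hv.apply_eq_smul
  have hlin : ∀ c : ℂ, Ψ c = c • Ψ 1 := fun c => by rw [← map_smul, smul_eq_mul, mul_one]
  by_cases ht : Φ v = 0
  · rw [ht, map_zero] at hv1
    rcases smul_eq_zero.1 hv1.symm with h0 | h0
    · simp [h0]
    · exact absurd h0 hv.2
  · have h2 := congrArg Φ hv1
    rw [hlin, map_smul, map_smul, smul_eq_mul, smul_eq_mul, mul_comm] at h2
    rwa [← mul_right_cancel₀ ht h2]

/-- A holomorphic family of maps of `ℂ` whose member at `0` has an attracting fixed point has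
attracting fixed points for all small parameters. -/
theorem eventually_exists_fixedPoint {G : ℂ × ℂ → ℂ} {U : Set (ℂ × ℂ)} (hU : IsOpen U)
    (hG : DifferentiableOn ℂ G U) {Z₀ : ℂ} (hZ₀ : (0, Z₀) ∈ U) (hfix : G (0, Z₀) = Z₀)
    (hmul : ‖fderiv ℂ G (0, Z₀) (0, 1)‖ < 1) :
    ∀ᶠ δ in 𝓝 (0 : ℂ), ∃ Z, (δ, Z) ∈ U ∧ G (δ, Z) = Z ∧ ‖fderiv ℂ G (δ, Z) (0, 1)‖ < 1 := by
  have hs := (hasStrictFDerivAt_of_differentiableOn hU hG hZ₀).sub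
    (hasStrictFDerivAt_snd (𝕜 := ℂ) (p := ((0 : ℂ), Z₀)))
  -- The implicit function theorem is applied to `G(δ, Z) - Z`, whose `Z`-derivative is the
  -- multiplier minus `1`.
  have hinv : ((fderiv ℂ G (0, Z₀) - ContinuousLinearMap.snd ℂ ℂ ℂ) ∘L
      .inr ℂ ℂ ℂ).IsInvertible := by
    apply isInvertible_of_apply_one_ne_zero
    intro h
    have h1 : fderiv ℂ G (0, Z₀) (0, 1) = 1 := sub_eq_zero.1 (by simpa using h)
    rw [h1, norm_one] at hmul
    exact lt_irrefl _ hmul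
  have hψ := hs.tendsto_implicitFunctionOfProdDomain hinv
  have hpair : Tendsto (fun δ => (δ, hs.implicitFunctionOfProdDomain hinv δ)) (𝓝 (0 : ℂ))
      (𝓝 (0, Z₀)) := tendsto_id.prodMk_nhds hψ
  have hcont : ContinuousAt (fun y => ‖fderiv ℂ G y (0, 1)‖) (0, Z₀) :=
    ((continuousAt_fderiv_of_differentiableOn hU hG hZ₀).clm_apply continuousAt_const).norm
  filter_upwards [hs.eventually_apply_implicitFunctionOfProdDomain hinv,
    hpair.eventually (hU.mem_nhds hZ₀),
    hpair.eventually (hcont.eventually (gt_mem_nhds hmul))] with δ h1 h2 h3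
  refine ⟨hs.implicitFunctionOfProdDomain hinv δ, h2, ?_, h3⟩
  simp only [Pi.sub_apply, hfix, sub_self] at h1
  exact sub_eq_zero.1 h1

/-- Derivatives along the slices of constant parameter of a composition of two holomorphic
families. -/
theorem hasFDerivAt_slice_comp {Φ : ℂ × ℂ × ℂ → ℂ} {Ψ : ℂ × ℂ → ℂ × ℂ} {y : ℂ × ℂ}
    (hΦ : DifferentiableAt ℂ Φ (y.1, Ψ y)) (hΨ : DifferentiableAt ℂ Ψ y) :
    ∃ (B : ℂ × ℂ →L[ℂ] ℂ) (C : ℂ →L[ℂ] ℂ × ℂ), HasFDerivAt (fun p => Φ (y.1, p)) B (Ψ y) ∧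
      HasFDerivAt (fun Z => Ψ (y.1, Z)) C y.2 ∧
      fderiv ℂ (fun y => Φ (y.1, Ψ y)) y (0, 1) = B (C 1) := by
  have d1 := HasFDerivAt.comp (g := Φ) (f := fun p => (y.1, p)) (Ψ y) hΦ.hasFDerivAt
    (hasFDerivAt_prodMk_right y.1 (Ψ y))
  have d2 := HasFDerivAt.comp (g := Ψ) (f := fun Z => (y.1, Z)) y.2 hΨ.hasFDerivAt
    (hasFDerivAt_prodMk_right y.1 y.2)
  refine ⟨_, _, d1, d2, ?_⟩
  have hS : HasFDerivAt (fun y => (y.1, Ψ y)) _ y := hasFDerivAt_fst.prodMk hΨ.hasFDerivAt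
  have hG : HasFDerivAt (fun y => Φ (y.1, Ψ y)) _ y := hΦ.hasFDerivAt.comp y hS
  rw [hG.fderiv]
  simp

/-- The multiplier of `Φ ∘ Ψ` for `δ = 0` is the multiplier of the Lavaurs map of `f`. -/
theorem norm_multiplier_lt_one {z : ℂ} (hL : IsAttractingFixedPoint (lavaurs₁ q) z) {p₀ : ℂ × ℂ}
    (hp₀ : p₀.1 = z) {B : ℂ × ℂ →L[ℂ] ℂ} {C : ℂ →L[ℂ] ℂ × ℂ}
    (hB : HasFDerivAt (attractingFatou₂ q 0) B p₀)
    (hC : HasFDerivAt (repellingFatou₂ q 0) C (attractingFatou₁ q z))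
    (hlim : ∀ᶠ Z in 𝓝 (attractingFatou₁ q z),
      Tendsto (repellingSeq₂ q 0 Z) atTop (𝓝 (repellingFatou₂ q 0 Z))) : ‖B (C 1)‖ < 1 := by
  obtain ⟨-, A, hA, hAμ⟩ := hL
  subst hp₀
  have a1 : HasFDerivAt (attractingFatou₁ q) (B ∘L .inl ℂ ℂ ℂ) p₀.1 := by
    have := HasFDerivAt.comp (f := fun w : ℂ => (w, p₀.2)) p₀.1 hB
      (hasFDerivAt_prodMk_left p₀.1 p₀.2)
    refine this.congr_of_eventuallyEq (Eventually.of_forall fun w => ?_)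
    exact (attractingFatou₂_zero q (w, p₀.2)).symm
  have a2 : HasFDerivAt (repellingFatou₁ q) (.fst ℂ ℂ ℂ ∘L C) (attractingFatou₁ q p₀.1) := by
    have := (hasFDerivAt_fst (𝕜 := ℂ)
      (p := repellingFatou₂ q 0 (attractingFatou₁ q p₀.1))).comp _ hC
    refine this.congr_of_eventuallyEq ?_
    filter_upwards [hlim] with Z hZ
    exact repellingFatou₁_eq q hZ
  have a3 : HasFDerivAt (lavaurs₁ q) ((.fst ℂ ℂ ℂ ∘L C) ∘L (B ∘L .inl ℂ ℂ ℂ)) p₀.1 :=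
    HasFDerivAt.comp p₀.1 a2 a1
  have hA1 : ‖A 1‖ < 1 := by
    refine hAμ (A 1) (Module.End.hasEigenvalue_of_hasEigenvector (x := 1)
      ⟨Module.End.mem_eigenspace_iff.2 ?_, one_ne_zero⟩)
    simp
  -- At `δ = 0` the attracting coordinate does not depend on `x`, so only the first component of `C
  -- 1` matters and `B (C 1)` is the product of the derivatives of `φ_f` and `ψ_f`.
  have hB1 : B = (B ∘L .inl ℂ ℂ ℂ) ∘L .fst ℂ ℂ ℂ := by
    refine hB.unique ((HasFDerivAt.comp p₀ a1 hasFDerivAt_fst).congr_of_eventuallyEq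
      (Eventually.of_forall fun p => attractingFatou₂_zero q p))
  have hlin : ∀ c : ℂ, C c = c • C 1 := fun c => by rw [← map_smul, smul_eq_mul, mul_one]
  have hlinB : ∀ c : ℂ, B (c, 0) = c * B (1, 0) := fun c => by
    rw [← smul_eq_mul, ← map_smul, Prod.smul_mk, smul_eq_mul, mul_one, smul_zero]
  have e : B (C 1) = A 1 := by
    rw [hA.unique a3, hB1]
    simp only [ContinuousLinearMap.comp_apply, ContinuousLinearMap.inl_apply,
      ContinuousLinearMap.coe_fst']
    rw [hlin (B (1, 0)), hlinB, Prod.smul_fst, smul_eq_mul, mul_comm]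
  rwa [e]

end LavaursMaps

theorem propositionB (q : ℂ[X]) (h0 : q.coeff 0 = 0) (h1 : q.coeff 1 = 0) (h2 : q.coeff 2 = 1)
    (hf : ∃ z ∈ parabolicBasin (oneDimMap q), IsAttractingFixedPoint (lavaurs₁ q) z) :
    ∃ δ₀ : ℝ, 0 < δ₀ ∧ ∀ δ : ℂ, 0 < ‖δ‖ → ‖δ‖ < δ₀ →
      ∃ p ∈ parabolicBasin (twoDimMap q δ),
        (∀ᶠ p' in 𝓝 p, Tendsto (attractingSeq₂ q δ p') atTop (𝓝 (attractingFatou₂ q δ p'))) ∧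
        (∀ᶠ Z in 𝓝 (attractingFatou₂ q δ p),
          Tendsto (repellingSeq₂ q δ Z) atTop (𝓝 (repellingFatou₂ q δ Z))) ∧
        IsAttractingFixedPoint (lavaurs₂ q δ) p := by
  obtain ⟨z, hz, hL⟩ := hf
  set Z₀ := attractingFatou₁ q z with hZ₀
  obtain ⟨ε₁, hε₁, hΨ, hΨlim⟩ := exists_ball_repellingFatou₂ h0 h1 h2 Z₀
  set Ψ : ℂ × ℂ → ℂ × ℂ := fun y => repellingFatou₂ q y.1 y.2 with hΨdef
  set p₀ := Ψ (0, Z₀) with hp₀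
  have hc₁ : ((0 : ℂ), Z₀) ∈ Metric.ball ((0 : ℂ), Z₀) ε₁ := Metric.mem_ball_self hε₁
  -- The point `p₀` lies over the fixed point of the Lavaurs map of `f`, hence over the basin of
  -- `f`.
  have hp₀z : p₀.1 = z := 
    (repellingFatou₁_eq q (hΨlim (0, Z₀) hc₁)).symm.trans hL.1
  obtain ⟨r, M, hb⟩ := exists_isStepBound q
  obtain ⟨N, hN⟩ := exists_iterate_attractingPetal_mem_nhds h0 h1 h2 hb (p := p₀)
    (by rwa [hp₀z])
  obtain ⟨ε₂, hε₂, hΦ, hΦlim⟩ := exists_ball_attractingFatou₂ h0 h1 h2 hb hN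
  set Φ : ℂ × ℂ × ℂ → ℂ := fun y => attractingFatou₂ q y.1 y.2 with hΦdef
  have hSd : DifferentiableOn ℂ (fun y => (y.1, Ψ y)) (Metric.ball (0, Z₀) ε₁) :=
    differentiableOn_fst.prodMk hΨ
  set U := Metric.ball ((0 : ℂ), Z₀) ε₁ ∩ (fun y => (y.1, Ψ y)) ⁻¹' Metric.ball (0, p₀) ε₂
    with hUdef
  have hU : IsOpen U :=
    hSd.continuousOn.isOpen_inter_preimage Metric.isOpen_ball Metric.isOpen_ball
  have hG : DifferentiableOn ℂ (fun y => Φ (y.1, Ψ y)) U :=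
    hΦ.comp (hSd.mono Set.inter_subset_left) fun y hy => hy.2
  have hZ₀U : ((0 : ℂ), Z₀) ∈ U := ⟨hc₁, Metric.mem_ball_self hε₂⟩
  have hslice : ∀ y ∈ U, ∃ (B : ℂ × ℂ →L[ℂ] ℂ) (C : ℂ →L[ℂ] ℂ × ℂ),
      HasFDerivAt (attractingFatou₂ q y.1) B (Ψ y) ∧
      HasFDerivAt (repellingFatou₂ q y.1) C y.2 ∧
      fderiv ℂ (fun y => Φ (y.1, Ψ y)) y (0, 1) = B (C 1) := fun y hy =>
    hasFDerivAt_slice_comp (hΦ.differentiableAt (Metric.isOpen_ball.mem_nhds hy.2))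
      (hΨ.differentiableAt (Metric.isOpen_ball.mem_nhds hy.1))
  have hnear₁ : ∀ y ∈ U, ∀ᶠ W in 𝓝 y.2,
      Tendsto (repellingSeq₂ q y.1 W) atTop (𝓝 (repellingFatou₂ q y.1 W)) := fun y hy => by
    filter_upwards [(Continuous.prodMk_right y.1).continuousAt.preimage_mem_nhds
      (Metric.isOpen_ball.mem_nhds hy.1)] with W hW
    exact hΨlim (y.1, W) hW
  have hfix : Φ (0, p₀) = Z₀ := by
    rw [hZ₀, ← hp₀z]
    exact attractingFatou₂_zero q p₀
  have hmul : ‖fderiv ℂ (fun y => Φ (y.1, Ψ y)) (0, Z₀) (0, 1)‖ < 1 := by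
    obtain ⟨B, C, d1, d2, d3⟩ := hslice (0, Z₀) hZ₀U
    rw [d3]
    exact norm_multiplier_lt_one hL hp₀z d1 d2 (hnear₁ (0, Z₀) hZ₀U)
  obtain ⟨δ₀, hδ₀, hball⟩ := Metric.eventually_nhds_iff.1
    (eventually_exists_fixedPoint hU hG hZ₀U hfix hmul)
  refine ⟨δ₀, hδ₀, fun δ _ hδ => ?_⟩
  obtain ⟨Z, hZU, hZfix, hZmul⟩ := hball (y := δ) (by rwa [dist_zero_right])
  obtain ⟨B, C, d1, d2, d3⟩ := hslice (δ, Z) hZU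
  -- A fixed point `Z` of `Φ ∘ Ψ` is turned into the fixed point `Ψ(δ, Z)` of `Ψ ∘ Φ`, with
  -- derivative `C ∘ B` in place of `B ∘ C`.
  have hΦp : attractingFatou₂ q δ (Ψ (δ, Z)) = Z := hZfix
  refine ⟨Ψ (δ, Z), (hΦlim (δ, Ψ (δ, Z)) hZU.2).1, ?_, ?_, ?_, C ∘L B, ?_, fun μ hμ =>
    norm_lt_one_of_hasEigenvalue_comp (by rwa [d3] at hZmul) hμ⟩
  · filter_upwards [(Continuous.prodMk_right δ).continuousAt.preimage_mem_nhds
      (Metric.isOpen_ball.mem_nhds hZU.2)] with p hp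
    exact (hΦlim (δ, p) hp).2
  · rw [hΦp]
    exact hnear₁ (δ, Z) hZU
  · rw [lavaurs₂, hΦp]
  · refine HasFDerivAt.comp (g := repellingFatou₂ q δ) (f := attractingFatou₂ q δ) (Ψ (δ, Z)) ?_ d1
    rw [hΦp]
    exact d2
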